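/- Let $J>0$. For an $L$-periodic spin configuration $\sigma\in\{\pm1\}^{\mathbb Z^2}$ (i.e. periodic with period $L\in\{1,2,\dots\}$ in both coordinate directions) let, with $\Lambda_L=\mathbb Z^2/L\mathbb Z^2$, $$\mathcal H_L(\sigma)=-\frac J2\sum_{\substack{x,y\in\Lambda_L\\ |x-y|=1}}(\sigma_x\sigma_y-1)+\frac12\sum_{x,y\in\Lambda_L}\ \sum_{m\in\mathbb Z^2}\frac{\sigma_x\sigma_y-1}{|x-y+Lm|^3},$$ where $|\cdot|$ is the Euclidean length, the diagonal terms $x=y$ of the second sum are zero, and in the first sum the neighbours of each $x$ are reached by the four unit steps $\pm(1,0),\pm(0,1)$. The energy per site is $\mathcal E(\sigma)=L^{-2}\mathcal H_L(\sigma)$; it does not depend on the choice of the period $L$. For positive integers $h,h_1,h_2$ let $\mathcal E_s(h)$ be the energy per site of the striped configuration $\sigma_x=(-1)^{\lfloor x_2/h\rfloor}$, and let $\mathcal E(h_1,h_2)$ be that of the checkerboard configuration $\sigma_x=(-1)^{\lfloor x_1/h_1\rfloor+\lfloor x_2/h_2\rfloor}$. Let $\gamma$ be the Euler--Mascheroni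 constant, let $K_1(x)=\frac1{2x}\int_{-\infty}^{\infty}\frac{e^{ixt}}{(t^2+1)^{3/2}}\,dt$ for $x>0$, and let $$\alpha_s=2\Big(1+\gamma-\log\frac\pi2+4\pi\sum_{j\ge1}\sum_{n\ge1}j\,K_1(2\pi jn)\Big),$$ $$c_{II}(\delta)=\frac{129}{9\pi}\,e^{-\alpha_s/2+4\delta},\qquad c_{III}(\delta)=\frac2\pi\,e^{2-\alpha_s/2-\delta/4-\delta^2}.$$ Let $\delta_*$ be the unique number in $(0,1]$ with $c_{II}(\delta_*)=c_{III}(\delta_*)$, and put $$c_{\min}=\tfrac12c_{III}(1),\qquad c_{\max}=c_{II}(1),\qquad \lambda_{\min}=\frac{\delta_*}{1+\delta_*}.$$ Lemma. There is a constant $J_{\min}>1$ such that, for all real $J,h,\lambda$ with $$J>J_{\min},\qquad c_{\min}e^{J/2}\le h\le c_{\max}e^{J/2},\qquad \lambda_{\min}\le\lambda\le\tfrac12,$$ and such that $h/\lambda$ and $h/(1-\lambda)$ are integers, $$\mathcal E\Big(\frac h\lambda,\frac h{1-\lambda}\Big)>\mathcal E_s(\lfloor h\rfloor).$$ -/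

import Mathlib

namespace DipolarIsing

noncomputable section

/-! ### Spin configurations and their energy -/

/-- An infinite volume Ising spin configuration, with spins `±1` on `ℤ²`. -/
abbrev Config : Type := ℤ × ℤ → ℤˣ

/-- `σ` is `L`-periodic in both coordinate directions. -/
def IsPeriodic (L : ℕ) (σ : Config) : Prop :=
  ∀ x : ℤ × ℤ, σ (x + ((L : ℤ), 0)) = σ x ∧ σ (x + (0, (L : ℤ))) = σ x

/-- The Euclidean length `|z|` of a lattice vector. -/
def len (z : ℤ × ℤ) : ℝ := Real.sqrt ((z.1 : ℝ) ^ 2 + (z.2 : ℝ) ^ 2)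

/-- `σ_x σ_y - 1`, as a real number. -/
def bond (σ : Config) (x y : ℤ × ℤ) : ℝ := (((σ x * σ y : ℤˣ) : ℤ) : ℝ) - 1

/-- The torus `Λ_L = ℤ² / Lℤ²`, through its representatives in `{0, …, L - 1}²`. -/
def torus (L : ℕ) : Finset (ℤ × ℤ) := Finset.Ico (0 : ℤ) L ×ˢ Finset.Ico (0 : ℤ) L

/-- The four lattice vectors of length one. -/
def unitVectors : Finset (ℤ × ℤ) := {(1, 0), (-1, 0), (0, 1), (0, -1)}

/-- The energy `H_L(σ)` in the box of side `L` with periodic boundary conditions,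
`-(J/2) ∑_{x, y ∈ Λ_L, |x - y| = 1} (σ_x σ_y - 1)
  + (1/2) ∑_{x, y ∈ Λ_L} ∑_{m ∈ ℤ²} (σ_x σ_y - 1) / |x - y + L m|³`,
for an `L`-periodic configuration. The nearest neighbours of a site of the torus are reached by
the four unit steps. The diagonal terms `x = y`, `m = 0` are zero, since `0 / 0 = 0`. -/
def energy (J : ℝ) (L : ℕ) (σ : Config) : ℝ :=
  -(J / 2) * ∑ x ∈ torus L, ∑ e ∈ unitVectors, bond σ x (x + e)
    + (1 / 2) * ∑ x ∈ torus L, ∑ y ∈ torus L, ∑' m : ℤ × ℤ,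
        bond σ x y / len (x - y + (L : ℤ) • m) ^ 3

/-- The least positive period of a configuration (zero if there is none). -/
def period (σ : Config) : ℕ := sInf {L : ℕ | 0 < L ∧ IsPeriodic L σ}

/-- The energy per site `H_L(σ) / L²` of a periodic configuration. It is computed here with the
least period; `energyPerSite_eq` shows that every period gives the same value. -/
def energyPerSite (J : ℝ) (σ : Config) : ℝ := energy J (period σ) σ / (period σ : ℝ) ^ 2

/-- The periodic striped configuration `(-1)^⌊x₂ / h⌋`. -/
def stripe (h : ℕ) : Config := fun x => (-1 : ℤˣ) ^ (x.2 / (h : ℤ))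

/-- The periodic checkerboard configuration with tiles of sides `h₁`, `h₂` in the two coordinate
directions and alternating signs. -/
def checkerboard (h₁ h₂ : ℕ) : Config :=
  fun x => (-1 : ℤˣ) ^ (x.1 / (h₁ : ℤ) + x.2 / (h₂ : ℤ))

/-- The stripe energy `E_s(h)` per site. -/
def stripeEnergy (J : ℝ) (h : ℕ) : ℝ := energyPerSite J (stripe h)

/-- The checkerboard energy `E(h₁, h₂)` per site, for finite sides. -/
def checkerboardEnergy (J : ℝ) (h₁ h₂ : ℕ) : ℝ := energyPerSite J (checkerboard h₁ h₂)

/-! ### The constants -/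

/-- The modified Bessel function `K₁(x) = (1 / (2x)) ∫ e^{ixt} / (t² + 1)^{3/2} dt`, `x > 0`
(the integral is real). -/
def besselK1 (x : ℝ) : ℝ :=
  1 / (2 * x) *
    (∫ t : ℝ, Complex.exp (Complex.I * x * t) / (((t ^ 2 + 1) ^ (3 / 2 : ℝ) : ℝ) : ℂ)).re

/-- `α_s = 2 (1 + γ - log (π/2) + 4π ∑_{j ≥ 1} ∑_{n ≥ 1} j K₁(2π j n))`. -/
def alphaS : ℝ :=
  2 * (1 + Real.eulerMascheroniConstant - Real.log (Real.pi / 2)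
    + 4 * Real.pi * ∑' j : ℕ, ∑' n : ℕ,
        ((j : ℝ) + 1) * besselK1 (2 * Real.pi * ((j : ℝ) + 1) * ((n : ℝ) + 1)))

/-- `c_II(δ) = (129 / (9π)) e^{-α_s/2 + 4δ}`. -/
def cII (δ : ℝ) : ℝ := 129 / (9 * Real.pi) * Real.exp (-(alphaS / 2) + 4 * δ)

/-- `c_III(δ) = (2 / π) e^{2 - α_s/2 - δ/4 - δ²}`. -/
def cIII (δ : ℝ) : ℝ := 2 / Real.pi * Real.exp (2 - alphaS / 2 - δ / 4 - δ ^ 2)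

theorem cII_eq_cIII_iff (δ : ℝ) :
    cII δ = cIII δ ↔ δ ^ 2 + 17 / 4 * δ = 2 - Real.log (129 / 18) := by
  have hpi := Real.pi_pos
  have h1 : cII δ = 2 / Real.pi * Real.exp (Real.log (129 / 18) + (-(alphaS / 2) + 4 * δ)) := by
    rw [cII, Real.exp_add (Real.log (129 / 18)), Real.exp_log (by norm_num), ← mul_assoc]
    congr 1
    field_simp
    norm_num
  rw [h1, cIII, mul_right_inj' (by positivity), Real.exp_eq_exp]
  constructor <;> intro h <;> linarith

theorem existsUnique_deltaStar : ∃! δ : ℝ, (0 < δ ∧ δ ≤ 1) ∧ cII δ = cIII δ := by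
  have hlog : Real.log (129 / 18) < 2 := by
    rw [Real.log_lt_iff_lt_exp (by norm_num), show (2 : ℝ) = 1 + 1 by norm_num, Real.exp_add]
    nlinarith [Real.exp_one_gt_d9]
  have hlog' : 0 < Real.log (129 / 18) := Real.log_pos (by norm_num)
  set c := 2 - Real.log (129 / 18) with hc
  have hcont : ContinuousOn (fun δ : ℝ => δ ^ 2 + 17 / 4 * δ) (Set.Icc 0 1) := by fun_prop
  have hmem : c ∈ Set.Icc ((fun δ : ℝ => δ ^ 2 + 17 / 4 * δ) 0)
      ((fun δ : ℝ => δ ^ 2 + 17 / 4 * δ) 1) := by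
    constructor <;> norm_num <;> linarith
  obtain ⟨δ, ⟨h0, h1⟩, hδ⟩ := intermediate_value_Icc (by norm_num) hcont hmem
  have hδ' : δ ^ 2 + 17 / 4 * δ = c := hδ
  have hpos : 0 < δ := by
    rcases h0.lt_or_eq with h | h
    · exact h
    · rw [← h] at hδ'; norm_num at hδ'; linarith
  refine ⟨δ, ⟨⟨hpos, h1⟩, (cII_eq_cIII_iff δ).2 hδ'⟩, ?_⟩
  rintro y ⟨⟨hy0, -⟩, hy⟩
  have hy' := (cII_eq_cIII_iff y).1 hy
  have : (y - δ) * (y + δ + 17 / 4) = 0 := by rw [← hc] at hy'; linarith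
  rcases mul_eq_zero.1 this with h | h <;> linarith

/-- `δ_*`, the unique number in `(0, 1]` with `c_II(δ_*) = c_III(δ_*)`. -/
def deltaStar : ℝ := existsUnique_deltaStar.choose

theorem deltaStar_spec : (0 < deltaStar ∧ deltaStar ≤ 1) ∧ cII deltaStar = cIII deltaStar :=
  existsUnique_deltaStar.choose_spec.1

/-- `c_min = c_III(1) / 2`. -/
def cMin : ℝ := cIII 1 / 2

/-- `c_max = c_II(1)`. -/
def cMax : ℝ := cII 1

/-- `λ_min = δ_* / (1 + δ_*)`. -/
def lambdaMin : ℝ := deltaStar / (1 + deltaStar)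

/-! ### The energy per site does not depend on the period -/

theorem summable_len : Summable fun z : ℤ × ℤ => 1 / len z ^ 3 := by
  have h := EisensteinSeries.summable_one_div_norm_rpow (k := 3) (by norm_num)
  have h' := (finTwoArrowEquiv ℤ).symm.summable_iff.2 h
  refine Summable.of_nonneg_of_le (fun z => by unfold len; positivity) (fun z => ?_) h'
  have hle : ‖((finTwoArrowEquiv ℤ).symm z : Fin 2 → ℤ)‖ ≤ len z := by
    unfold len
    rw [pi_norm_le_iff_of_nonneg (Real.sqrt_nonneg _)]
    intro i
    apply Real.le_sqrt_of_sq_le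
    fin_cases i <;> simp [Int.norm_eq_abs] <;> positivity
  simp only [Function.comp]
  rcases eq_or_ne z 0 with rfl | hz
  · simp [len]
  · have hpos : 0 < ‖((finTwoArrowEquiv ℤ).symm z : Fin 2 → ℤ)‖ := by
      rw [norm_pos_iff]
      intro h0
      apply hz
      have := congrArg (finTwoArrowEquiv ℤ) h0
      simpa [Prod.mk_zero_zero] using this
    rw [Real.rpow_neg (norm_nonneg _), one_div]
    apply inv_anti₀ (by positivity)
    rw [show (3 : ℝ) = ((3 : ℕ) : ℝ) by norm_num, Real.rpow_natCast]
    gcongr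

theorem IsPeriodic.add_smul {L : ℕ} {σ : Config} (h : IsPeriodic L σ) (x m : ℤ × ℤ) :
    σ (x + (L : ℤ) • m) = σ x := by
  have h1 : Function.Periodic σ ((L : ℤ), 0) := fun x => (h x).1
  have h2 : Function.Periodic σ (0, (L : ℤ)) := fun x => (h x).2
  have : (L : ℤ) • m = m.1 • ((L : ℤ), (0 : ℤ)) + m.2 • ((0 : ℤ), (L : ℤ)) := by
    ext <;> simp [mul_comm]
  rw [this, ← add_assoc, h2.zsmul m.2, h1.zsmul m.1]

/-- Dipolar part of the energy of one site. -/
def siteDipole (σ : Config) (x : ℤ × ℤ) : ℝ := ∑' z : ℤ × ℤ, bond σ x (x + z) / len z ^ 3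

theorem abs_bond_le (σ : Config) (x y : ℤ × ℤ) : |bond σ x y| ≤ 2 := by
  unfold bond
  rcases Int.units_eq_one_or (σ x * σ y) with h | h <;> rw [h] <;> norm_num

theorem len_neg (z : ℤ × ℤ) : len (-z) = len z := by simp [len]

theorem summable_dipole (σ : Config) (x : ℤ × ℤ) :
    Summable fun z : ℤ × ℤ => bond σ x (x + z) / len z ^ 3 := by
  refine Summable.of_norm_bounded (summable_len.mul_left 2) fun z => ?_
  have hn : 0 ≤ len z ^ 3 := by unfold len; positivity
  rw [Real.norm_eq_abs, abs_div, abs_of_nonneg hn, div_eq_mul_one_div]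
  exact mul_le_mul_of_nonneg_right (abs_bond_le _ _ _) (by positivity)

/-- A lattice point is a point of the box plus `L` times a lattice vector. -/
def boxEquiv (L : ℕ) [NeZero L] : torus L × (ℤ × ℤ) ≃ ℤ × ℤ where
  toFun p := p.1.1 + (L : ℤ) • p.2
  invFun z := ⟨⟨(z.1 % L, z.2 % L), by
    have : (0 : ℤ) < L := by exact_mod_cast Nat.pos_of_ne_zero (NeZero.ne L)
    simp only [torus, Finset.mem_product, Finset.mem_Ico]
    exact ⟨⟨Int.emod_nonneg _ this.ne', Int.emod_lt_of_pos _ this⟩,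
      Int.emod_nonneg _ this.ne', Int.emod_lt_of_pos _ this⟩⟩, (z.1 / L, z.2 / L)⟩
  left_inv := by
    rintro ⟨⟨⟨a, b⟩, hab⟩, ⟨m, n⟩⟩
    have : (0 : ℤ) < L := by exact_mod_cast Nat.pos_of_ne_zero (NeZero.ne L)
    simp only [torus, Finset.mem_product, Finset.mem_Ico] at hab
    obtain ⟨⟨h1, h2⟩, h3, h4⟩ := hab
    simp [Int.emod_eq_of_lt h1 h2, Int.emod_eq_of_lt h3 h4, Int.add_mul_ediv_left _ _ this.ne',
      Int.ediv_eq_zero_of_lt h1 h2, Int.ediv_eq_zero_of_lt h3 h4]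
  right_inv := by
    rintro ⟨a, b⟩
    ext <;> simp [Int.emod_add_mul_ediv]

theorem sum_dipole {L : ℕ} (hL : 0 < L) {σ : Config} (h : IsPeriodic L σ) (x : ℤ × ℤ) :
    ∑ y ∈ torus L, ∑' m : ℤ × ℤ, bond σ x y / len (x - y + (L : ℤ) • m) ^ 3
      = siteDipole σ x := by
  have : NeZero L := ⟨hL.ne'⟩
  let E : torus L × (ℤ × ℤ) ≃ ℤ × ℤ :=
    ((Equiv.refl _).prodCongr (Equiv.neg (ℤ × ℤ))).trans
      ((boxEquiv L).trans (Equiv.subRight x))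
  have hE : ∀ p : torus L × (ℤ × ℤ), bond σ x (x + E p) / len (E p) ^ 3
      = bond σ x p.1.1 / len (x - p.1.1 + (L : ℤ) • p.2) ^ 3 := by
    rintro ⟨y, m⟩
    have h1 : E (y, m) = y.1 + (L : ℤ) • (-m) - x := rfl
    have h2 : x + E (y, m) = y.1 + (L : ℤ) • (-m) := by rw [h1]; abel
    have h3 : x - y.1 + (L : ℤ) • m = -E (y, m) := by rw [h1, smul_neg]; abel
    simp only []
    rw [h2, h3, len_neg]
    unfold bond
    rw [h.add_smul]
  have hs := (E.summable_iff.2 (summable_dipole σ x))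
  simp only [Function.comp_def] at hs
  simp only [hE] at hs
  rw [siteDipole, ← E.tsum_eq]
  simp only [hE]
  rw [hs.tsum_prod, tsum_fintype, ← Finset.sum_coe_sort]

theorem energy_eq {J : ℝ} {L : ℕ} (hL : 0 < L) {σ : Config} (h : IsPeriodic L σ) :
    energy J L σ = ∑ x ∈ torus L,
      (-(J / 2) * ∑ e ∈ unitVectors, bond σ x (x + e) + (1 / 2) * siteDipole σ x) := by
  simp only [energy, sum_dipole hL h, Finset.sum_add_distrib, Finset.mul_sum]

theorem sum_Ico_mul {f : ℤ → ℝ} {L : ℕ} (n : ℕ) (hf : ∀ a, f (a + L) = f a) :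
    ∑ a ∈ Finset.Ico (0 : ℤ) ((n * L : ℕ) : ℤ), f a
      = n * ∑ a ∈ Finset.Ico (0 : ℤ) (L : ℤ), f a := by
  have key : ∀ k : ℕ, ∑ a ∈ Finset.Ico (0 : ℤ) (k : ℤ), f a = ∑ i ∈ Finset.range k, f i := by
    intro k
    refine (Finset.sum_nbij (fun i : ℕ => (i : ℤ)) ?_ ?_ ?_ ?_).symm
    · intro i hi; simpa using hi
    · intro i _ j _ hij; simpa using hij
    · intro a ha
      simp only [Finset.coe_Ico, Set.mem_Ico] at ha
      exact ⟨a.toNat, by simp; omega, by simp [ha.1]⟩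
    · intro i _; rfl
  rw [key, key]
  induction n with
  | zero => simp
  | succ n ih =>
    have hp : Function.Periodic f (L : ℤ) := hf
    rw [add_mul, one_mul, Finset.sum_range_add, ih]
    push_cast
    rw [add_mul, one_mul]
    congr 1
    refine Finset.sum_congr rfl fun i _ => ?_
    rw [add_comm]
    exact hp.int_mul n i

theorem sum_torus_mul {F : ℤ × ℤ → ℝ} {L : ℕ} (n : ℕ)
    (h1 : ∀ x, F (x + ((L : ℤ), 0)) = F x) (h2 : ∀ x, F (x + (0, (L : ℤ))) = F x) :
    ∑ x ∈ torus (n * L), F x = (n : ℝ) ^ 2 * ∑ x ∈ torus L, F x := by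
  unfold torus
  rw [Finset.sum_product, Finset.sum_product]
  have hin : ∀ a : ℤ, ∑ b ∈ Finset.Ico (0 : ℤ) ((n * L : ℕ) : ℤ), F (a, b)
      = n * ∑ b ∈ Finset.Ico (0 : ℤ) (L : ℤ), F (a, b) := fun a =>
    sum_Ico_mul (f := fun b => F (a, b)) n fun b => by simpa using h2 (a, b)
  simp only [hin]
  rw [sum_Ico_mul (f := fun a => (n : ℝ) * ∑ b ∈ Finset.Ico (0 : ℤ) (L : ℤ), F (a, b)) n
    (fun a => by
      congr 1
      exact Finset.sum_congr rfl fun b _ => by simpa using h1 (a, b)), ← Finset.mul_sum]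
  ring

theorem energy_mul {J : ℝ} {L n : ℕ} (hL : 0 < L) (hn : 0 < n) {σ : Config}
    (h : IsPeriodic L σ) : energy J (n * L) σ = (n : ℝ) ^ 2 * energy J L σ := by
  have hnL : IsPeriodic (n * L) σ := fun x => by
    have h1 := h.add_smul x ((n : ℤ), 0)
    have h2 := h.add_smul x (0, (n : ℤ))
    constructor
    · rw [← h1]; congr 1; ext <;> simp [mul_comm]
    · rw [← h2]; congr 1; ext <;> simp [mul_comm]
  rw [energy_eq hL h, energy_eq (Nat.mul_pos hn hL) hnL]
  have hb : ∀ v : ℤ × ℤ, (∀ x, σ (x + v) = σ x) → ∀ x z, bond σ (x + v) (x + v + z)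
      = bond σ x (x + z) := fun v hv x z => by
    unfold bond
    rw [hv, add_right_comm, hv]
  refine sum_torus_mul n (fun x => ?_) (fun x => ?_)
  · simp only [siteDipole, hb _ (fun x => (h x).1)]
  · simp only [siteDipole, hb _ (fun x => (h x).2)]

/-- The energy per site may be computed in any box whose side is a period. -/
theorem energyPerSite_eq (J : ℝ) {L : ℕ} (hL : 0 < L) {σ : Config} (h : IsPeriodic L σ) :
    energyPerSite J σ = energy J L σ / (L : ℝ) ^ 2 := by
  obtain ⟨hp, hper⟩ : 0 < period σ ∧ IsPeriodic (period σ) σ :=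
    Nat.sInf_mem (s := {L : ℕ | 0 < L ∧ IsPeriodic L σ}) ⟨L, hL, h⟩
  have e1 := energy_mul (J := J) hL hp h
  have e2 := energy_mul (J := J) hp hL hper
  rw [mul_comm] at e2
  rw [energyPerSite, div_eq_div_iff (by positivity) (by positivity)]
  linarith

theorem stripe_isPeriodic {h : ℕ} (hh : 0 < h) : IsPeriodic (2 * h) (stripe h) := by
  have hz : (h : ℤ) ≠ 0 := by exact_mod_cast hh.ne'
  intro x
  constructor
  · simp [stripe]
  · have : (x.2 + ((2 * h : ℕ) : ℤ)) / (h : ℤ) = x.2 / h + 2 := by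
      push_cast
      exact Int.add_mul_ediv_right _ _ hz
    simp only [stripe, Prod.snd_add, this, zpow_add]
    simp

theorem checkerboard_isPeriodic {h₁ h₂ : ℕ} (hh₁ : 0 < h₁) (hh₂ : 0 < h₂) :
    IsPeriodic (2 * h₁ * h₂) (checkerboard h₁ h₂) := by
  have hz₁ : (h₁ : ℤ) ≠ 0 := by exact_mod_cast hh₁.ne'
  have hz₂ : (h₂ : ℤ) ≠ 0 := by exact_mod_cast hh₂.ne'
  intro x
  constructor
  · have : (x.1 + ((2 * h₁ * h₂ : ℕ) : ℤ)) / (h₁ : ℤ) = x.1 / h₁ + 2 * h₂ := by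
      rw [← Int.add_mul_ediv_right _ _ hz₁]
      congr 1
      push_cast
      ring
    simp only [checkerboard, Prod.fst_add, Prod.snd_add, this, add_zero]
    rw [add_right_comm, zpow_add _ _ (2 * (h₂ : ℤ)), zpow_mul]
    simp
  · have : (x.2 + ((2 * h₁ * h₂ : ℕ) : ℤ)) / (h₂ : ℤ) = x.2 / h₂ + 2 * h₁ := by
      rw [← Int.add_mul_ediv_right _ _ hz₂]
      congr 1
    simp only [checkerboard, Prod.fst_add, Prod.snd_add, this, add_zero]
    rw [← add_assoc, zpow_add _ _ (2 * (h₁ : ℤ)), zpow_mul]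
    simp

end

end DipolarIsing

open Filter Topology

namespace DipolarIsing

noncomputable section

/-! ### Energy of product configurations -/

/-! Both configurations are products of one-dimensional block waves, so their energies depend only
on the triangle wave `dis k`, which is `|n| / k` on `[-k, k]` and has period `2 * k`. Expanding `(1
- 2a)(1 - 2b) - 1 = -2a - 2b + 4ab` gives, with `S = stripeDipole` and `C = cornerDipole`, `E_s(k) =
2J/k - S(k)` and `E(h₁, h₂) = 2J(1/h₁ + 1/h₂) - S(h₁) - S(h₂) + 2 C(h₁, h₂)`. For `h₁ = h/λ`, `h₂ =
h/(1 - λ)` one has `1/h₁ + 1/h₂ = 1/h`, so up to the rounding of `h` the exchange terms agree and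
the claim concerns the dipolar terms alone.

Two estimates carry the proof. The first is `k S(k) = 4 log k + c + o(1)`
(`exists_tendsto_stripeDipole`); the value of `c` is irrelevant, because it enters with total weight
`λ + (1 - λ) - 1 = 0`. The second is the lower bound for the corner repulsion (`le_cornerDipole`),
`2 h₁ C(h₁, h₂) ≥ 4 log(h₁/h₂) + 2 log(4/3) + 8 - 4 log 2 - o(1)`.

Multiply the energy difference by `h`. The terms in `log h₁` cancel, and what remains is at least `4
log(1 - λ) + λ (2 log(4/3) + 8 - 4 log 2) - o(1)`. By concavity `log(1 - λ) ≥ -2λ log 2` on `[0,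
1/2]`, so this is at least `λ (2 log(4/3) + 8 - 12 log 2) - o(1) ≥ λ/5 - o(1)`. Since `λ ≥ λ_min >
0`, the errors are negligible once `J`, and with it `h ≥ c_min e^{J/2}`, is large. -/

/-- The configuration `u(x₁) v(x₂)`. -/
def prodConfig (u v : ℤ → ℤˣ) : Config := fun x => u x.1 * v x.2

/-- The autocorrelation of a one-dimensional configuration over `L` sites. -/
def autocorr (L : ℕ) (u : ℤ → ℤˣ) (n : ℤ) : ℝ :=
  (∑ a ∈ Finset.Ico (0 : ℤ) (L : ℤ), (((u a * u (a + n) : ℤˣ) : ℤ) : ℝ)) / L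

theorem bond_prodConfig (u v : ℤ → ℤˣ) (x z : ℤ × ℤ) :
    bond (prodConfig u v) x (x + z) = (((u x.1 * u (x.1 + z.1) : ℤˣ) : ℤ) : ℝ)
      * (((v x.2 * v (x.2 + z.2) : ℤˣ) : ℤ) : ℝ) - 1 := by
  simp only [bond, prodConfig, Prod.fst_add, Prod.snd_add]
  push_cast
  ring

theorem sum_bond_prodConfig {L : ℕ} (hL : 0 < L) (u v : ℤ → ℤˣ) (z : ℤ × ℤ) :
    ∑ x ∈ torus L, bond (prodConfig u v) x (x + z)
      = (L : ℝ) ^ 2 * (autocorr L u z.1 * autocorr L v z.2 - 1) := by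
  have hL' : (L : ℝ) ≠ 0 := by positivity
  have hcard : ((torus L).card : ℝ) = (L : ℝ) ^ 2 := by
    simp [torus, Finset.card_product, sq]
  simp only [bond_prodConfig, Finset.sum_sub_distrib, Finset.sum_const, nsmul_eq_mul, hcard]
  rw [torus, Finset.sum_product]
  simp only [← Finset.mul_sum, ← Finset.sum_mul, autocorr]
  field_simp

/-- Averaging over the base point before summing over displacements makes the spin correlation
factorise into two one-dimensional autocorrelations. -/
theorem energyPerSite_prodConfig (J : ℝ) {L : ℕ} (hL : 0 < L) {u v : ℤ → ℤˣ}
    (hu : ∀ a, u (a + L) = u a) (hv : ∀ a, v (a + L) = v a) :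
    energyPerSite J (prodConfig u v)
      = -(J / 2) * ∑ e ∈ unitVectors, (autocorr L u e.1 * autocorr L v e.2 - 1)
        + 1 / 2 * ∑' z : ℤ × ℤ, (autocorr L u z.1 * autocorr L v z.2 - 1) / len z ^ 3 := by
  have hL' : (L : ℝ) ≠ 0 := by positivity
  have hper : IsPeriodic L (prodConfig u v) := fun x => by
    constructor <;> simp [prodConfig, hu, hv]
  have h1 : ∑ x ∈ torus L, ∑ e ∈ unitVectors, bond (prodConfig u v) x (x + e)
      = (L : ℝ) ^ 2 * ∑ e ∈ unitVectors, (autocorr L u e.1 * autocorr L v e.2 - 1) := by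
    rw [Finset.sum_comm, Finset.mul_sum]
    exact Finset.sum_congr rfl fun e _ => sum_bond_prodConfig hL u v e
  have h2 : ∑ x ∈ torus L, siteDipole (prodConfig u v) x
      = (L : ℝ) ^ 2 * ∑' z : ℤ × ℤ, (autocorr L u z.1 * autocorr L v z.2 - 1) / len z ^ 3 := by
    simp only [siteDipole]
    rw [← Summable.tsum_finsetSum fun x _ => summable_dipole _ x, ← tsum_mul_left]
    refine tsum_congr fun z => ?_
    rw [← Finset.sum_div, sum_bond_prodConfig hL, mul_div_assoc]
  rw [energyPerSite_eq J hL hper, energy_eq hL hper, Finset.sum_add_distrib, ← Finset.mul_sum,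
    ← Finset.mul_sum, h1, h2]
  field_simp

theorem autocorr_mul {L : ℕ} (hL : 0 < L) {n : ℕ} (hn : 0 < n) {u : ℤ → ℤˣ}
    (hu : ∀ a, u (a + L) = u a) (m : ℤ) : autocorr (n * L) u m = autocorr L u m := by
  have hL' : (L : ℝ) ≠ 0 := by positivity
  have hn' : (n : ℝ) ≠ 0 := by positivity
  rw [autocorr, autocorr, sum_Ico_mul (f := fun a => (((u a * u (a + m) : ℤˣ) : ℤ) : ℝ)) n
    (fun a => by rw [hu, add_right_comm, hu])]
  push_cast
  field_simp

/-! ### The triangle wave -/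

/-- The alternating one-dimensional configuration with blocks of length `h`. -/
def tile (h : ℕ) : ℤ → ℤˣ := fun a => (-1) ^ (a / (h : ℤ))

theorem tile_add {h : ℕ} (hh : 0 < h) (a : ℤ) : tile h (a + h) = -tile h a := by
  have hz : (h : ℤ) ≠ 0 := by exact_mod_cast hh.ne'
  have : (a + h) / (h : ℤ) = a / h + 1 := by
    simpa using Int.add_mul_ediv_right a 1 hz
  simp [tile, this, zpow_add]

theorem tile_periodic {h : ℕ} (hh : 0 < h) (a : ℤ) : tile h (a + ((2 * h : ℕ) : ℤ)) = tile h a := by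
  have : a + ((2 * h : ℕ) : ℤ) = a + h + h := by push_cast; ring
  rw [this, tile_add hh, tile_add hh, neg_neg]

/-- The fraction of sites whose spin in the configuration `tile h` differs from the spin at
distance `n`. -/
def dis (h : ℕ) (n : ℤ) : ℝ := (1 - autocorr (2 * h) (tile h) n) / 2

theorem autocorr_tile (h : ℕ) (n : ℤ) : autocorr (2 * h) (tile h) n = 1 - 2 * dis h n := by
  unfold dis; ring

theorem autocorr_antiperiodic {h : ℕ} (hh : 0 < h) (n : ℤ) :
    autocorr (2 * h) (tile h) (n + h) = -autocorr (2 * h) (tile h) n := by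
  simp only [autocorr, ← add_assoc, tile_add hh, ← neg_div, ← Finset.sum_neg_distrib]
  simp

theorem dis_add {h : ℕ} (hh : 0 < h) (n : ℤ) : dis h (n + h) = 1 - dis h n := by
  simp only [dis, autocorr_antiperiodic hh]; ring

theorem dis_periodic {h : ℕ} (hh : 0 < h) : Function.Periodic (dis h) ((2 * h : ℕ) : ℤ) := by
  intro n
  have : n + ((2 * h : ℕ) : ℤ) = n + h + h := by push_cast; ring
  rw [this, dis_add hh, dis_add hh]; ring

theorem tile_of_mem {h : ℕ} {a : ℤ} (h0 : 0 ≤ a) (h1 : a < h) : tile h a = 1 := by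
  simp [tile, Int.ediv_eq_zero_of_lt h0 h1]

theorem tile_of_mem' {h : ℕ} {a : ℤ} (h0 : (h : ℤ) ≤ a) (h1 : a < 2 * h) : tile h a = -1 := by
  rcases Nat.eq_zero_or_pos h with rfl | hh
  · simp at h0 h1; omega
  have h2 := tile_add hh (a - h)
  have h3 : tile h (a - h) = 1 := tile_of_mem (by omega) (by omega)
  rwa [sub_add_cancel, h3] at h2

theorem sum_Ico_int {f : ℤ → ℝ} (k : ℕ) :
    ∑ a ∈ Finset.Ico (0 : ℤ) (k : ℤ), f a = ∑ i ∈ Finset.range k, f i := by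
  refine (Finset.sum_nbij (fun i : ℕ => (i : ℤ)) ?_ ?_ ?_ ?_).symm
  · intro i hi; simpa using hi
  · intro i _ j _ hij; simpa using hij
  · intro a ha
    simp only [Finset.coe_Ico, Set.mem_Ico] at ha
    exact ⟨a.toNat, by simp; omega, by simp [ha.1]⟩
  · intro i _; rfl

theorem dis_natCast {h n : ℕ} (hh : 0 < h) (hn : n ≤ h) : dis h n = n / h := by
  obtain ⟨m, rfl⟩ := Nat.exists_eq_add_of_le hn
  have key : ∑ a ∈ Finset.Ico (0 : ℤ) ((2 * (n + m) : ℕ) : ℤ),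
      (((tile (n + m) a * tile (n + m) (a + n) : ℤˣ) : ℤ) : ℝ) = 2 * m - 2 * n := by
    -- One period splits into runs of lengths `m, n, m, n`, with `h = n + m`; a spin and its
    -- translate by `n` agree on the first and third runs and differ on the other two.
    rw [sum_Ico_int, show 2 * (n + m) = m + n + m + n by ring, Finset.sum_range_add,
      Finset.sum_range_add, Finset.sum_range_add]
    have c1 : ∀ i ∈ Finset.range m, (((tile (n + m) ((i : ℕ) : ℤ)
        * tile (n + m) ((i : ℕ) + n) : ℤˣ) : ℤ) : ℝ) = 1 := fun i hi => by
      have := Finset.mem_range.1 hi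
      rw [tile_of_mem (by omega) (by push_cast; omega), tile_of_mem (by omega) (by push_cast; omega)]
      simp
    have c2 : ∀ i ∈ Finset.range n, (((tile (n + m) ((m + i : ℕ) : ℤ)
        * tile (n + m) ((m + i : ℕ) + n) : ℤˣ) : ℤ) : ℝ) = -1 := fun i hi => by
      have := Finset.mem_range.1 hi
      rw [tile_of_mem (by omega) (by push_cast; omega),
        tile_of_mem' (by push_cast; omega) (by push_cast; omega)]
      simp
    have c3 : ∀ i ∈ Finset.range m, (((tile (n + m) ((m + n + i : ℕ) : ℤ)
        * tile (n + m) ((m + n + i : ℕ) + n) : ℤˣ) : ℤ) : ℝ) = 1 := fun i hi => by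
      have := Finset.mem_range.1 hi
      rw [tile_of_mem' (by push_cast; omega) (by push_cast; omega),
        tile_of_mem' (by push_cast; omega) (by push_cast; omega)]
      simp
    have c4 : ∀ i ∈ Finset.range n, (((tile (n + m) ((m + n + m + i : ℕ) : ℤ)
        * tile (n + m) ((m + n + m + i : ℕ) + n) : ℤˣ) : ℤ) : ℝ) = -1 := fun i hi => by
      have := Finset.mem_range.1 hi
      have e : ((m + n + m + i : ℕ) : ℤ) + n = (i : ℤ) + ((2 * (n + m) : ℕ) : ℤ) := by
        push_cast; ring
      rw [e, tile_periodic (by omega), tile_of_mem' (by push_cast; omega) (by push_cast; omega),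
        tile_of_mem (by omega) (by push_cast; omega)]
      simp
    rw [Finset.sum_congr rfl c1, Finset.sum_congr rfl c2, Finset.sum_congr rfl c3,
      Finset.sum_congr rfl c4]
    simp
    ring
  have h0 : ((n : ℝ) + m) ≠ 0 := by exact_mod_cast hh.ne'
  rw [dis, autocorr, key]
  push_cast
  field_simp
  ring

theorem dis_zero {h : ℕ} (hh : 0 < h) : dis h 0 = 0 := by
  simpa using dis_natCast (n := 0) hh (Nat.zero_le _)

theorem dis_of_nonneg {h : ℕ} (hh : 0 < h) {n : ℤ} (h0 : 0 ≤ n) (h1 : n ≤ h) :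
    dis h n = n / h := by
  lift n to ℕ using h0
  simpa using dis_natCast hh (n := n) (by exact_mod_cast h1)

theorem dis_of_nonpos {h : ℕ} (hh : 0 < h) {n : ℤ} (h0 : n ≤ 0) (h1 : -(h : ℤ) ≤ n) :
    dis h n = -n / h := by
  have h3 := dis_add hh n
  rw [dis_of_nonneg hh (by omega) (by omega)] at h3
  have : (h : ℝ) ≠ 0 := by positivity
  push_cast at h3
  field_simp at h3 ⊢
  linarith

theorem dis_of_abs_le {h : ℕ} (hh : 0 < h) {n : ℤ} (hn : |n| ≤ h) : dis h n = |(n : ℝ)| / h := by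
  rcases le_total 0 n with h0 | h0
  · rw [abs_of_nonneg h0] at hn
    rw [dis_of_nonneg hh h0 hn, abs_of_nonneg (by exact_mod_cast h0)]
  · rw [abs_of_nonpos h0] at hn
    rw [dis_of_nonpos hh h0 (by omega), abs_of_nonpos (by exact_mod_cast h0)]

/-- Folding into the fundamental interval `[-h, h]`. Both signs are recorded so that evenness
follows without a separate computation. -/
theorem exists_dis_eq {h : ℕ} (hh : 0 < h) (n : ℤ) :
    ∃ s : ℤ, |s| ≤ h ∧ dis h n = dis h s ∧ dis h (-n) = dis h (-s) := by
  have hp := dis_periodic hh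
  have hpos : (0 : ℤ) < ((2 * h : ℕ) : ℤ) := by exact_mod_cast (by omega : 0 < 2 * h)
  have red : ∀ a j : ℤ, dis h (a + ((2 * h : ℕ) : ℤ) * j) = dis h a := fun a j => by
    rw [mul_comm]; exact hp.int_mul j a
  have e := Int.emod_add_mul_ediv n ((2 * h : ℕ) : ℤ)
  have hr0 := Int.emod_nonneg n hpos.ne'
  have hr1 := Int.emod_lt_of_pos n hpos
  set r := n % ((2 * h : ℕ) : ℤ)
  set q := n / ((2 * h : ℕ) : ℤ)
  rcases le_total r h with hr | hr
  · refine ⟨r, by rw [abs_of_nonneg hr0]; exact hr, ?_, ?_⟩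
    · rw [← e, red]
    · rw [← e, ← red (-r) (-q)]; congr 1; ring
  · refine ⟨r - ((2 * h : ℕ) : ℤ), by rw [abs_le]; push_cast at hr1 ⊢; constructor <;> omega, ?_, ?_⟩
    · rw [← e, ← red (r - _) (q + 1)]; congr 1; ring
    · rw [← e, ← red (-(r - _)) (-(q + 1))]; congr 1; ring

theorem dis_neg {h : ℕ} (hh : 0 < h) (n : ℤ) : dis h (-n) = dis h n := by
  obtain ⟨s, hs, h1, h2⟩ := exists_dis_eq hh n
  rw [h1, h2, dis_of_abs_le hh hs, dis_of_abs_le hh (by rwa [abs_neg])]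
  simp

theorem dis_nonneg {h : ℕ} (hh : 0 < h) (n : ℤ) : 0 ≤ dis h n := by
  obtain ⟨s, hs, h1, -⟩ := exists_dis_eq hh n
  rw [h1, dis_of_abs_le hh hs]
  positivity

theorem dis_le_one {h : ℕ} (hh : 0 < h) (n : ℤ) : dis h n ≤ 1 := by
  obtain ⟨s, hs, h1, -⟩ := exists_dis_eq hh n
  rw [h1, dis_of_abs_le hh hs, div_le_one (by positivity)]
  exact_mod_cast hs

theorem mul_dis_le {h : ℕ} (hh : 0 < h) (n : ℕ) : h * dis h n ≤ n := by
  have hpos : (0 : ℝ) < h := by positivity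
  rcases le_total n h with hn | hn
  · rw [dis_natCast hh hn, mul_div_cancel₀ _ hpos.ne']
  · calc h * dis h n ≤ h * 1 := by gcongr; exact dis_le_one hh _
      _ ≤ n := by simpa using hn

/-! ### The energies as lattice sums -/

/-- The dipolar energy gain per site of stripes of width `k`. -/
def stripeDipole (k : ℕ) : ℝ := ∑' z : ℤ × ℤ, dis k z.2 / len z ^ 3

/-- The dipolar interaction between the two directions of a checkerboard. -/
def cornerDipole (h₁ h₂ : ℕ) : ℝ := ∑' z : ℤ × ℤ, dis h₁ z.1 * dis h₂ z.2 / len z ^ 3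

theorem len_nonneg (z : ℤ × ℤ) : 0 ≤ len z := Real.sqrt_nonneg _

theorem len_swap (z : ℤ × ℤ) : len z.swap = len z := by simp [len, add_comm]

theorem summable_div_len {F : ℤ × ℤ → ℝ} (h0 : ∀ z, 0 ≤ F z) (h1 : ∀ z, F z ≤ 1) :
    Summable fun z => F z / len z ^ 3 :=
  Summable.of_nonneg_of_le (fun z => div_nonneg (h0 z) (pow_nonneg (len_nonneg z) 3))
    (fun z => div_le_div_of_nonneg_right (h1 z) (pow_nonneg (len_nonneg z) 3)) summable_len

theorem summable_dis_snd {k : ℕ} (hk : 0 < k) :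
    Summable fun z : ℤ × ℤ => dis k z.2 / len z ^ 3 :=
  summable_div_len (fun _ => dis_nonneg hk _) fun _ => dis_le_one hk _

theorem summable_dis_mul {h₁ h₂ : ℕ} (hh₁ : 0 < h₁) (hh₂ : 0 < h₂) :
    Summable fun z : ℤ × ℤ => dis h₁ z.1 * dis h₂ z.2 / len z ^ 3 :=
  summable_div_len (fun _ => mul_nonneg (dis_nonneg hh₁ _) (dis_nonneg hh₂ _)) fun _ =>
    mul_le_one₀ (dis_le_one hh₁ _) (dis_nonneg hh₂ _) (dis_le_one hh₂ _)

theorem hasSum_dis_fst {k : ℕ} (hk : 0 < k) :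
    HasSum (fun z : ℤ × ℤ => dis k z.1 / len z ^ 3) (stripeDipole k) := by
  have h := (summable_dis_snd hk).hasSum
  rw [← (Equiv.prodComm ℤ ℤ).hasSum_iff] at h
  simpa [Function.comp_def, len_swap, stripeDipole] using h

theorem stripeDipole_nonneg {k : ℕ} (hk : 0 < k) : 0 ≤ stripeDipole k :=
  tsum_nonneg fun z => div_nonneg (dis_nonneg hk _) (pow_nonneg (len_nonneg z) 3)

theorem sum_unitVectors (F : ℤ × ℤ → ℝ) :
    ∑ e ∈ unitVectors, F e = F (1, 0) + F (-1, 0) + F (0, 1) + F (0, -1) := by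
  have : unitVectors = {(1, 0), (-1, 0), (0, 1), (0, -1)} := rfl
  rw [this, Finset.sum_insert (by decide), Finset.sum_insert (by decide),
    Finset.sum_insert (by decide), Finset.sum_singleton]
  ring

theorem dis_one {k : ℕ} (hk : 0 < k) : dis k 1 = 1 / k := by
  simpa using dis_natCast (n := 1) hk hk

theorem stripeEnergy_eq (J : ℝ) {k : ℕ} (hk : 0 < k) :
    stripeEnergy J k = 2 * J / k - stripeDipole k := by
  have hs : stripe k = prodConfig (fun _ => 1) (tile k) := by
    funext x; simp [stripe, prodConfig, tile]
  have hc : ∀ n, autocorr (2 * k) (fun _ => 1) n = 1 := fun n => by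
    have : (2 * (k : ℝ)) ≠ 0 := by positivity
    simp only [autocorr, sum_Ico_int]
    simp [this]
  rw [stripeEnergy, hs, energyPerSite_prodConfig J (L := 2 * k) (by omega) (fun _ => rfl)
    (tile_periodic hk)]
  simp only [hc, autocorr_tile, sum_unitVectors, dis_zero hk, dis_neg hk, dis_one hk]
  have e : ∀ z : ℤ × ℤ, (1 * (1 - 2 * dis k z.2) - 1) / len z ^ 3
      = (-2) * (dis k z.2 / len z ^ 3) := fun z => by ring
  simp only [e, tsum_mul_left, stripeDipole]
  ring

theorem checkerboardEnergy_eq (J : ℝ) {h₁ h₂ : ℕ} (hh₁ : 0 < h₁) (hh₂ : 0 < h₂) :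
    checkerboardEnergy J h₁ h₂ = 2 * J * (1 / h₁ + 1 / h₂) - stripeDipole h₁ - stripeDipole h₂
      + 2 * cornerDipole h₁ h₂ := by
  have hs : checkerboard h₁ h₂ = prodConfig (tile h₁) (tile h₂) := by
    funext x; simp [checkerboard, prodConfig, tile, zpow_add]
  have p1 := tile_periodic hh₁
  have p2 := tile_periodic hh₂
  have L1 : 2 * h₁ * h₂ = h₂ * (2 * h₁) := by ring
  have L2 : 2 * h₁ * h₂ = h₁ * (2 * h₂) := by ring
  have q1 : ∀ a, tile h₁ (a + ((2 * h₁ * h₂ : ℕ) : ℤ)) = tile h₁ a := fun a => by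
    have : Function.Periodic (tile h₁) ((2 * h₁ : ℕ) : ℤ) := p1
    rw [L1, Nat.cast_mul]; exact this.int_mul h₂ a
  have q2 : ∀ a, tile h₂ (a + ((2 * h₁ * h₂ : ℕ) : ℤ)) = tile h₂ a := fun a => by
    have : Function.Periodic (tile h₂) ((2 * h₂ : ℕ) : ℤ) := p2
    rw [L2, Nat.cast_mul]; exact this.int_mul h₁ a
  have c1 : ∀ n, autocorr (2 * h₁ * h₂) (tile h₁) n = 1 - 2 * dis h₁ n := fun n => by
    rw [L1, autocorr_mul (by omega) hh₂ p1, autocorr_tile]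
  have c2 : ∀ n, autocorr (2 * h₁ * h₂) (tile h₂) n = 1 - 2 * dis h₂ n := fun n => by
    rw [L2, autocorr_mul (by omega) hh₁ p2, autocorr_tile]
  rw [checkerboardEnergy, hs, energyPerSite_prodConfig J (L := 2 * h₁ * h₂) (by positivity) q1 q2]
  simp only [c1, c2, sum_unitVectors, dis_zero hh₁, dis_zero hh₂, dis_neg hh₁, dis_neg hh₂,
    dis_one hh₁, dis_one hh₂]
  have e : ∀ z : ℤ × ℤ, ((1 - 2 * dis h₁ z.1) * (1 - 2 * dis h₂ z.2) - 1) / len z ^ 3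
      = (-2) * (dis h₁ z.1 / len z ^ 3) + (-2) * (dis h₂ z.2 / len z ^ 3)
        + 4 * (dis h₁ z.1 * dis h₂ z.2 / len z ^ 3) := fun z => by ring
  have hsum := (((hasSum_dis_fst hh₁).mul_left (-2)).add
    ((summable_dis_snd hh₂).hasSum.mul_left (-2))).add
      ((summable_dis_mul hh₁ hh₂).hasSum.mul_left 4)
  simp only [e]
  rw [hsum.tsum_eq]
  simp only [stripeDipole, cornerDipole]
  ring

/-! ### Summation by columns -/

/-- The inverse cube `|(m, n)|⁻³`. -/
def ker (m n : ℤ) : ℝ := 1 / len (m, n) ^ 3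

/-- The sum of the inverse cubes of the lattice vectors in a row. -/
def rowSum (n : ℤ) : ℝ := ∑' m : ℤ, ker m n

theorem ker_nonneg (m n : ℤ) : 0 ≤ ker m n :=
  div_nonneg zero_le_one (pow_nonneg (len_nonneg _) 3)

theorem ker_neg_left (m n : ℤ) : ker (-m) n = ker m n := by simp [ker, len]

theorem ker_neg_right (m n : ℤ) : ker m (-n) = ker m n := by simp [ker, len]

theorem rowSum_neg (n : ℤ) : rowSum (-n) = rowSum n := by simp [rowSum, ker_neg_right]

theorem summable_ker : Summable fun z : ℤ × ℤ => ker z.1 z.2 := summable_len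

theorem summable_ker_left (n : ℤ) : Summable fun m : ℤ => ker m n :=
  summable_ker.comp_injective (i := fun m : ℤ => (m, n)) fun a b hab => by simpa using hab

theorem rowSum_nonneg (n : ℤ) : 0 ≤ rowSum n := tsum_nonneg fun m => ker_nonneg m n

theorem tsum_int_of_even {g : ℤ → ℝ} (hg : Summable g) (he : ∀ n, g (-n) = g n) :
    ∑' n : ℤ, g n = 2 * (∑' n : ℕ, g n) - g 0 := by
  have h1 : Summable fun n : ℕ => g n := hg.comp_injective Nat.cast_injective
  have h2 : Summable fun n : ℕ => g ((n + 1 : ℕ) : ℤ) := (summable_nat_add_iff 1).2 h1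
  have e : ∀ n : ℕ, g (-((n : ℤ) + 1)) = g ((n + 1 : ℕ) : ℤ) := fun n => by
    rw [he]; push_cast; rfl
  rw [tsum_of_nat_of_neg_add_one h1 (by simpa only [e] using h2)]
  simp only [e]
  have := h1.tsum_eq_zero_add
  simp only [Nat.cast_zero] at this
  linarith

theorem summable_dis_rowSum {k : ℕ} (hk : 0 < k) : Summable fun n : ℤ => dis k n * rowSum n := by
  have h := ((Equiv.prodComm ℤ ℤ).summable_iff.2 (summable_dis_snd hk)).prod
  refine h.congr fun n => ?_
  rw [rowSum, ← tsum_mul_left]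
  refine tsum_congr fun m => ?_
  simp [ker, div_eq_mul_inv]

theorem stripeDipole_eq {k : ℕ} (hk : 0 < k) :
    stripeDipole k = 2 * ∑' n : ℕ, dis k n * rowSum n := by
  have h := (summable_dis_snd hk)
  have h' := (Equiv.prodComm ℤ ℤ).summable_iff.2 h
  have e : ∑' n : ℤ, dis k n * rowSum n = stripeDipole k := by
    rw [stripeDipole, ← (Equiv.prodComm ℤ ℤ).tsum_eq]
    have := h'.tsum_prod
    simp only [Function.comp_def] at this
    rw [this]
    refine tsum_congr fun n => ?_
    rw [rowSum, ← tsum_mul_left]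
    refine tsum_congr fun m => ?_
    simp [ker, div_eq_mul_inv]
  rw [← e, tsum_int_of_even (summable_dis_rowSum hk) fun n => by rw [dis_neg hk, rowSum_neg],
    dis_zero hk]
  ring

/-- The sum over a half row of the kernel against the triangle wave. -/
def halfRow (h : ℕ) (n : ℤ) : ℝ := ∑' m : ℕ, dis h m * ker m n

theorem summable_dis_ker {h : ℕ} (hh : 0 < h) (n : ℤ) :
    Summable fun m : ℤ => dis h m * ker m n :=
  Summable.of_nonneg_of_le (fun m => mul_nonneg (dis_nonneg hh m) (ker_nonneg m n))
    (fun m => mul_le_of_le_one_left (ker_nonneg m n) (dis_le_one hh m)) (summable_ker_left n)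

theorem tsum_dis_ker {h : ℕ} (hh : 0 < h) (n : ℤ) :
    ∑' m : ℤ, dis h m * ker m n = 2 * halfRow h n := by
  rw [tsum_int_of_even (summable_dis_ker hh n) fun m => by rw [dis_neg hh, ker_neg_left],
    dis_zero hh, halfRow]
  ring

theorem halfRow_nonneg {h : ℕ} (hh : 0 < h) (n : ℤ) : 0 ≤ halfRow h n :=
  tsum_nonneg fun m => mul_nonneg (dis_nonneg hh m) (ker_nonneg m n)

theorem halfRow_neg (h : ℕ) (n : ℤ) : halfRow h (-n) = halfRow h n := by
  simp [halfRow, ker_neg_right]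

theorem summable_dis_halfRow {h₁ h₂ : ℕ} (hh₁ : 0 < h₁) (hh₂ : 0 < h₂) :
    Summable fun n : ℤ => dis h₂ n * halfRow h₁ n := by
  have h := ((Equiv.prodComm ℤ ℤ).summable_iff.2 (summable_dis_mul hh₁ hh₂)).prod
  refine (h.mul_left (1 / 2)).congr fun n => ?_
  have : halfRow h₁ n = 1 / 2 * ∑' m : ℤ, dis h₁ m * ker m n := by
    rw [tsum_dis_ker hh₁]; ring
  rw [this, mul_left_comm, ← tsum_mul_left (a := dis h₂ n)]
  congr 1
  refine tsum_congr fun m => ?_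
  simp [ker, div_eq_mul_inv]
  ring

theorem cornerDipole_eq {h₁ h₂ : ℕ} (hh₁ : 0 < h₁) (hh₂ : 0 < h₂) :
    cornerDipole h₁ h₂ = 4 * ∑' n : ℕ, dis h₂ n * halfRow h₁ n := by
  have h' := (Equiv.prodComm ℤ ℤ).summable_iff.2 (summable_dis_mul hh₁ hh₂)
  have e : 2 * ∑' n : ℤ, dis h₂ n * halfRow h₁ n = cornerDipole h₁ h₂ := by
    rw [cornerDipole, ← (Equiv.prodComm ℤ ℤ).tsum_eq]
    have := h'.tsum_prod
    simp only [Function.comp_def] at this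
    rw [this, ← tsum_mul_left]
    refine tsum_congr fun n => ?_
    rw [mul_left_comm, ← tsum_dis_ker hh₁, ← tsum_mul_left]
    refine tsum_congr fun m => ?_
    simp [ker, div_eq_mul_inv]
    ring
  rw [← e, tsum_int_of_even (summable_dis_halfRow hh₁ hh₂)
    fun n => by rw [dis_neg hh₂, halfRow_neg], dis_zero hh₂]
  ring

/-! ### Asymptotics of the row sums -/

theorem hasDerivAt_primitive {n : ℝ} (hn : 0 < n) (x : ℝ) :
    HasDerivAt (fun x => x / (n ^ 2 * √(x ^ 2 + n ^ 2))) (1 / √(x ^ 2 + n ^ 2) ^ 3) x := by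
  have hp : 0 < x ^ 2 + n ^ 2 := by positivity
  have h1 : HasDerivAt (fun x : ℝ => x ^ 2 + n ^ 2) (2 * x) x := by
    simpa using (hasDerivAt_pow 2 x).add_const (n ^ 2)
  have h2 := (h1.sqrt hp.ne').const_mul (n ^ 2)
  have hs : 0 < √(x ^ 2 + n ^ 2) := Real.sqrt_pos.2 hp
  have h3 := (hasDerivAt_id x).div h2 (by positivity)
  refine h3.congr_deriv ?_
  have hsq := Real.sq_sqrt hp.le
  simp only [id]
  field_simp
  rw [hsq]
  ring

theorem ker_eq (m n : ℤ) : ker m n = 1 / √((m : ℝ) ^ 2 + (n : ℝ) ^ 2) ^ 3 := rfl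

/-- The increment of the primitive is the value of the kernel at an intermediate point of `[m, m +
1]`, and the kernel decreases there. -/
theorem ker_le_primitive_sub {n : ℕ} (hn : 0 < n) (m : ℕ) :
    ker ((m + 1 : ℕ) : ℤ) n ≤ ((m + 1 : ℕ) : ℝ) / (n ^ 2 * √(((m + 1 : ℕ) : ℝ) ^ 2 + n ^ 2))
        - (m : ℝ) / (n ^ 2 * √((m : ℝ) ^ 2 + n ^ 2))
      ∧ ((m + 1 : ℕ) : ℝ) / (n ^ 2 * √(((m + 1 : ℕ) : ℝ) ^ 2 + n ^ 2))
        - (m : ℝ) / (n ^ 2 * √((m : ℝ) ^ 2 + n ^ 2)) ≤ ker m n := by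
  have hn' : (0 : ℝ) < n := by positivity
  have hm : (m : ℝ) < ((m + 1 : ℕ) : ℝ) := by push_cast; linarith
  obtain ⟨c, ⟨hc0, hc1⟩, hc⟩ := exists_hasDerivAt_eq_slope _ _ hm
    (fun x _ => (hasDerivAt_primitive hn' x).continuousAt.continuousWithinAt)
    (fun x _ => hasDerivAt_primitive hn' x)
  have hone : ((m + 1 : ℕ) : ℝ) - m = 1 := by push_cast; ring
  rw [hone, div_one] at hc
  rw [← hc, ker_eq, ker_eq]
  have hm0 : (0 : ℝ) ≤ m := by positivity
  have hc' : 0 < c := lt_of_le_of_lt hm0 hc0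
  push_cast at hc1 ⊢
  constructor <;> gcongr

theorem tendsto_primitive {n : ℕ} (hn : 0 < n) :
    Tendsto (fun m : ℕ => (m : ℝ) / (n ^ 2 * √((m : ℝ) ^ 2 + n ^ 2))) atTop
      (𝓝 (1 / (n : ℝ) ^ 2)) := by
  have hn' : (0 : ℝ) < n := by positivity
  have h1 : Tendsto (fun m : ℕ => 1 / ((n : ℝ) ^ 2 * √(1 + ((n : ℝ) / m) ^ 2))) atTop
      (𝓝 (1 / ((n : ℝ) ^ 2 * √(1 + 0 ^ 2)))) := by
    have := tendsto_const_div_atTop_nhds_zero_nat (n : ℝ)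
    have h2 : Tendsto (fun m : ℕ => (n : ℝ) ^ 2 * √(1 + ((n : ℝ) / m) ^ 2)) atTop
        (𝓝 ((n : ℝ) ^ 2 * √(1 + 0 ^ 2))) :=
      (((this.pow 2).const_add 1).sqrt).const_mul _
    exact tendsto_const_nhds.div h2 (by simp [hn'.ne'])
  simp only [ne_eq, OfNat.ofNat_ne_zero, not_false_eq_true, zero_pow, add_zero, Real.sqrt_one,
    mul_one] at h1
  refine h1.congr' ?_
  filter_upwards [eventually_gt_atTop 0] with m hm
  have hm' : (0 : ℝ) < m := by positivity
  have : (m : ℝ) ^ 2 + n ^ 2 = m ^ 2 * (1 + ((n : ℝ) / m) ^ 2) := by field_simp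
  rw [this, Real.sqrt_mul (by positivity), Real.sqrt_sq hm'.le]
  field_simp

theorem summable_ker_nat (n : ℤ) : Summable fun m : ℕ => ker m n :=
  (summable_ker_left n).comp_injective Nat.cast_injective

theorem ker_zero (n : ℕ) : ker 0 n = 1 / (n : ℝ) ^ 3 := by
  simp [ker_eq]

theorem rowSum_eq (n : ℕ) : rowSum n = 2 * (∑' m : ℕ, ker m n) - 1 / (n : ℝ) ^ 3 := by
  rw [rowSum, tsum_int_of_even (summable_ker_left n) fun m => ker_neg_left m n, ker_zero]

/-- Integral test: `∫₀^∞ (x² + n²)^{-3/2} dx = 1/n²`, and the lower and upper sums differ by the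
single term `ker 0 n = 1/n³`. -/
theorem abs_rowSum_sub_le {n : ℕ} (hn : 0 < n) :
    |rowSum n - 2 / (n : ℝ) ^ 2| ≤ 1 / (n : ℝ) ^ 3 := by
  have hn' : (0 : ℝ) < n := by positivity
  set g : ℕ → ℝ := fun m => (m : ℝ) / (n ^ 2 * √((m : ℝ) ^ 2 + n ^ 2)) with hg
  have hs := summable_ker_nat n
  have g0 : g 0 = 0 := by simp [hg]
  have lower : 1 / (n : ℝ) ^ 2 ≤ ∑' m : ℕ, ker m n := by
    refine le_of_tendsto (tendsto_primitive hn) (Eventually.of_forall fun M => ?_)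
    calc g M = ∑ m ∈ Finset.range M, (g (m + 1) - g m) := by rw [Finset.sum_range_sub, g0, sub_zero]
      _ ≤ ∑ m ∈ Finset.range M, ker m n :=
        Finset.sum_le_sum fun m _ => (ker_le_primitive_sub hn m).2
      _ ≤ _ := hs.sum_le_tsum _ fun m _ => ker_nonneg _ _
  have upper : ∑' m : ℕ, ker ((m + 1 : ℕ) : ℤ) n ≤ 1 / (n : ℝ) ^ 2 := by
    refine le_of_tendsto_of_tendsto ((summable_nat_add_iff 1).2 hs).hasSum.tendsto_sum_nat
      (tendsto_primitive hn) (Eventually.of_forall fun M => ?_)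
    calc ∑ m ∈ Finset.range M, ker ((m + 1 : ℕ) : ℤ) n
        ≤ ∑ m ∈ Finset.range M, (g (m + 1) - g m) :=
          Finset.sum_le_sum fun m _ => (ker_le_primitive_sub hn m).1
      _ = g M := by rw [Finset.sum_range_sub, g0, sub_zero]
  have h0 := hs.tsum_eq_zero_add
  rw [Nat.cast_zero, ker_zero] at h0
  have e : (2 : ℝ) / n ^ 2 = 2 * (1 / n ^ 2) := by ring
  rw [rowSum_eq, e, abs_le]
  constructor <;> linarith

/-! ### Second differences of the logarithm -/

/-- The negative second difference of the logarithm. -/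
def logDiff (n : ℕ) : ℝ := 2 * Real.log n - Real.log ((n : ℝ) - 1) - Real.log ((n : ℝ) + 1)

theorem abs_logDiff_sub_le {n : ℕ} (hn : 2 ≤ n) :
    |logDiff n - 1 / (n : ℝ) ^ 2| ≤ 1 / (n : ℝ) ^ 3 := by
  have hn' : (2 : ℝ) ≤ n := by exact_mod_cast hn
  have e : logDiff n = Real.log ((n : ℝ) ^ 2 / ((n : ℝ) ^ 2 - 1)) := by
    rw [show (n : ℝ) ^ 2 - 1 = (n - 1) * (n + 1) by ring, Real.log_div (by positivity)
      (mul_ne_zero (by linarith) (by linarith)), Real.log_mul (by linarith) (by linarith),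
      Real.log_pow, logDiff]
    push_cast
    ring
  have hq : (0 : ℝ) < (n : ℝ) ^ 2 - 1 := by nlinarith
  have hn0 : (0 : ℝ) < n := by linarith
  have up : logDiff n ≤ (n : ℝ) ^ 2 / ((n : ℝ) ^ 2 - 1) - 1 := by
    rw [e]; exact Real.log_le_sub_one_of_pos (by positivity)
  have lo : 1 - ((n : ℝ) ^ 2 / ((n : ℝ) ^ 2 - 1))⁻¹ ≤ logDiff n := by
    rw [e]; exact Real.one_sub_inv_le_log_of_pos (by positivity)
  have lo' : 1 / (n : ℝ) ^ 2 ≤ logDiff n := by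
    convert lo using 1; field_simp; ring
  have up' : (n : ℝ) ^ 2 / ((n : ℝ) ^ 2 - 1) - 1 ≤ 1 / (n : ℝ) ^ 2 + 1 / (n : ℝ) ^ 3 := by
    have : 1 / (n : ℝ) ^ 2 + 1 / (n : ℝ) ^ 3 - ((n : ℝ) ^ 2 / ((n : ℝ) ^ 2 - 1) - 1)
        = ((n : ℝ) ^ 2 - n - 1) / ((n : ℝ) ^ 3 * ((n : ℝ) ^ 2 - 1)) := by
      field_simp; ring
    have h2 : 0 ≤ ((n : ℝ) ^ 2 - n - 1) / ((n : ℝ) ^ 3 * ((n : ℝ) ^ 2 - 1)) :=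
      div_nonneg (by nlinarith) (by positivity)
    linarith
  have : 0 ≤ 1 / (n : ℝ) ^ 3 := by positivity
  rw [abs_le]
  constructor <;> linarith

/-- Both terms are `2/n² + O(1/n³)`. The logarithmic one is chosen because its sum against a
triangle wave telescopes exactly. -/
theorem abs_rowSum_sub_logDiff_le {n : ℕ} (hn : 0 < n) :
    |rowSum n - 2 * logDiff n| ≤ 5 / (n : ℝ) ^ 3 := by
  have h1 := abs_le.1 (abs_rowSum_sub_le hn)
  rcases Nat.lt_or_ge n 2 with h | h
  · obtain rfl : n = 1 := by omega
    -- Here `log 0 = 0`, so `logDiff 1` is negative; the constant `5` is large enough to cover this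
    -- case.
    have hl : logDiff 1 = -Real.log 2 := by
      have : (1 : ℝ) + 1 = 2 := by norm_num
      simp [logDiff, this]
    have hl2 := Real.log_two_lt_d9
    have hl3 := Real.log_two_gt_d9
    rw [hl, abs_le]
    norm_num at h1 ⊢
    constructor <;> linarith
  · have h2 := abs_le.1 (abs_logDiff_sub_le h)
    have e : (2 : ℝ) / n ^ 2 = 2 * (1 / n ^ 2) := by ring
    have e' : (5 : ℝ) / n ^ 3 = 5 * (1 / n ^ 3) := by ring
    have : 0 ≤ 1 / (n : ℝ) ^ 3 := by positivity
    rw [e']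
    rw [e] at h1
    rw [abs_le]
    constructor <;> linarith

theorem sum_range_mul_secondDiff (g : ℤ → ℝ) (k : ℕ) :
    ∑ s ∈ Finset.range k, (s : ℝ) * (2 * g s - g (s - 1) - g (s + 1))
      = g k - g 0 - k * (g k - g (k - 1)) := by
  induction k with
  | zero => simp
  | succ k ih =>
    rw [Finset.sum_range_succ, ih]
    have : ((k + 1 : ℕ) : ℤ) - 1 = k := by push_cast; ring
    rw [this]
    push_cast
    ring

theorem sum_range_secondDiff (g : ℤ → ℝ) (k : ℕ) :
    ∑ s ∈ Finset.range k, (2 * g s - g (s - 1) - g (s + 1))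
      = g 0 - g (-1) - (g k - g (k - 1)) := by
  induction k with
  | zero => simp
  | succ k ih =>
    rw [Finset.sum_range_succ, ih]
    have : ((k + 1 : ℕ) : ℤ) - 1 = k := by push_cast; ring
    rw [this]
    push_cast
    ring

/-- Summation by parts: the tent rising on `[0, k]` and falling on `[k, 2k]` has second difference
supported at its three corners. No decay or regularity of `g` enters, so junk values of the
logarithm at nonpositive integers are harmless. -/
theorem sum_range_tent (g : ℤ → ℝ) (k : ℕ) :
    ∑ s ∈ Finset.range k, (s : ℝ) * (2 * g s - g (s - 1) - g (s + 1))
      + ∑ s ∈ Finset.range k, ((k : ℝ) - s)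
          * (2 * g (k + s) - g (k + s - 1) - g (k + s + 1)) = 2 * g k - g 0 - g (2 * k) := by
  have h1 := sum_range_mul_secondDiff (fun s => g (k + s)) k
  have h2 := sum_range_secondDiff (fun s => g (k + s)) k
  simp only [← add_assoc, add_zero, ← add_sub_assoc] at h1 h2
  rw [sum_range_mul_secondDiff]
  simp only [sub_mul _ _ (2 * g _ - g _ - g _), Finset.sum_sub_distrib (f := fun _ => _ * _),
    ← Finset.mul_sum]
  rw [h1, h2, two_mul (k : ℤ), ← sub_eq_add_neg]
  ring

theorem dis_block {k : ℕ} (hk : 0 < k) (j : ℕ) {s : ℕ} (hs : s ≤ k) :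
    (k : ℝ) * dis k ((j * (2 * k) + s : ℕ) : ℤ) = s := by
  have hk' : (k : ℝ) ≠ 0 := by positivity
  have := (dis_periodic hk).nat_mul j s
  rw [show ((j * (2 * k) + s : ℕ) : ℤ) = s + (j : ℤ) * ((2 * k : ℕ) : ℤ) by push_cast; ring, this,
    dis_natCast hk hs]
  field_simp

theorem dis_block' {k : ℕ} (hk : 0 < k) (j : ℕ) {s : ℕ} (hs : s ≤ k) :
    (k : ℝ) * dis k ((j * (2 * k) + (k + s) : ℕ) : ℤ) = k - s := by
  have := dis_add hk ((j * (2 * k) + s : ℕ) : ℤ)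
  have h2 := dis_block hk j hs
  rw [show ((j * (2 * k) + (k + s) : ℕ) : ℤ) = ((j * (2 * k) + s : ℕ) : ℤ) + k by push_cast; ring,
    this, mul_sub, h2, mul_one]

theorem sum_block_logDiff {k : ℕ} (hk : 0 < k) (j : ℕ) :
    ∑ s ∈ Finset.range (2 * k), (k : ℝ) * dis k ((j * (2 * k) + s : ℕ) : ℤ)
        * logDiff (j * (2 * k) + s)
      = 2 * Real.log ((2 * j + 1) * k) - Real.log (2 * j * k) - Real.log ((2 * j + 2) * k) := by
  have h := sum_range_tent (fun s : ℤ => Real.log (j * (2 * k) + s)) k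
  rw [two_mul k, Finset.sum_range_add]
  have e1 : ∀ s ∈ Finset.range k, (k : ℝ) * dis k ((j * (k + k) + s : ℕ) : ℤ)
      * logDiff (j * (k + k) + s) = s * (2 * Real.log (j * (2 * k) + ((s : ℤ) : ℝ))
        - Real.log (j * (2 * k) + (((s : ℤ) - 1 : ℤ) : ℝ))
        - Real.log (j * (2 * k) + (((s : ℤ) + 1 : ℤ) : ℝ))) := fun s hs => by
    rw [← two_mul, dis_block hk j (Finset.mem_range.1 hs).le, logDiff]
    push_cast
    ring_nf
  have e2 : ∀ s ∈ Finset.range k, (k : ℝ) * dis k ((j * (k + k) + (k + s) : ℕ) : ℤ)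
      * logDiff (j * (k + k) + (k + s))
      = (k - s) * (2 * Real.log (j * (2 * k) + (((k : ℤ) + s : ℤ) : ℝ))
        - Real.log (j * (2 * k) + (((k : ℤ) + s - 1 : ℤ) : ℝ))
        - Real.log (j * (2 * k) + (((k : ℤ) + s + 1 : ℤ) : ℝ))) := fun s hs => by
    rw [← two_mul, dis_block' hk j (Finset.mem_range.1 hs).le, logDiff]
    push_cast
    ring_nf
  rw [Finset.sum_congr rfl e1, Finset.sum_congr rfl e2, h]
  push_cast
  ring_nf

/-- In a block `j ≥ 1` the coefficients `2 - 1 - 1` of `log k` cancel, so the block sum does not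
depend on `k`. In block `0` the convention `log 0 = 0` removes one term, which leaves `log k` once.
-/
theorem sum_dis_logDiff {k : ℕ} (hk : 0 < k) (j : ℕ) :
    ∑ n ∈ Finset.range ((j + 1) * (2 * k)), (k : ℝ) * dis k (n : ℤ) * logDiff n
      - ∑ n ∈ Finset.range ((j + 1) * (2 * 1)), ((1 : ℕ) : ℝ) * dis 1 (n : ℤ) * logDiff n
      = Real.log k := by
  have hk' : (k : ℝ) ≠ 0 := by positivity
  induction j with
  | zero =>
    have h1 := sum_block_logDiff hk 0
    have h2 := sum_block_logDiff one_pos 0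
    simp only [zero_mul, zero_add, one_mul] at h1 h2 ⊢
    rw [h1, h2]
    have : Real.log (2 * k) = Real.log 2 + Real.log k := Real.log_mul (by norm_num) hk'
    norm_num [this]
    ring
  | succ j ih =>
    rw [add_mul (j + 1), add_mul (j + 1), one_mul, one_mul, Finset.sum_range_add,
      Finset.sum_range_add, sum_block_logDiff hk, sum_block_logDiff one_pos]
    rw [Real.log_mul (by positivity) hk', Real.log_mul (by positivity) hk',
      Real.log_mul (by positivity) hk']
    push_cast at ih ⊢
    simp only [mul_one, one_mul] at ih ⊢
    linarith

/-! ### Asymptotics of the stripe energy -/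

theorem abs_dis_mul_le {k : ℕ} (hk : 0 < k) (n : ℕ) :
    |(k : ℝ) * dis k n * (rowSum n - 2 * logDiff n)| ≤ 5 / (n : ℝ) ^ 2 := by
  rcases Nat.eq_zero_or_pos n with rfl | hn
  · simp [dis_zero hk]
  · have hn' : (0 : ℝ) < n := by positivity
    have h0 : 0 ≤ (k : ℝ) * dis k n := mul_nonneg (by positivity) (dis_nonneg hk _)
    rw [abs_mul, abs_of_nonneg h0]
    calc (k : ℝ) * dis k n * |rowSum n - 2 * logDiff n| ≤ n * (5 / (n : ℝ) ^ 3) :=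
          mul_le_mul (mul_dis_le hk n) (abs_rowSum_sub_logDiff_le hn) (abs_nonneg _) hn'.le
      _ = 5 / (n : ℝ) ^ 2 := by field_simp

theorem summable_five_div_sq : Summable fun n : ℕ => 5 / (n : ℝ) ^ 2 := by
  simpa [div_eq_mul_inv] using
    (Real.summable_nat_pow_inv.2 (by norm_num : 1 < 2)).mul_left 5

theorem summable_dis_remainder {k : ℕ} (hk : 0 < k) :
    Summable fun n : ℕ => (k : ℝ) * dis k n * (rowSum n - 2 * logDiff n) :=
  Summable.of_norm_bounded summable_five_div_sq fun n => abs_dis_mul_le hk n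

theorem summable_dis_rowSum_nat {k : ℕ} (hk : 0 < k) :
    Summable fun n : ℕ => dis k n * rowSum n :=
  (summable_dis_rowSum hk).comp_injective Nat.cast_injective

theorem summable_dis_logDiff {k : ℕ} (hk : 0 < k) :
    Summable fun n : ℕ => (k : ℝ) * dis k n * logDiff n := by
  refine ((((summable_dis_rowSum_nat hk).mul_left (k : ℝ)).sub
    (summable_dis_remainder hk)).mul_left (1 / 2)).congr fun n => ?_
  ring

theorem tsum_dis_logDiff {k : ℕ} (hk : 0 < k) :
    ∑' n : ℕ, (k : ℝ) * dis k n * logDiff n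
      = Real.log k + ∑' n : ℕ, ((1 : ℕ) : ℝ) * dis 1 n * logDiff n := by
  have t : ∀ k : ℕ, 0 < k → Tendsto (fun j : ℕ => (j + 1) * (2 * k)) atTop atTop := fun k hk =>
    tendsto_atTop_mono (fun j => (Nat.le_succ j).trans (Nat.le_mul_of_pos_right _ (by omega)))
      tendsto_id
  have h1 := (summable_dis_logDiff hk).hasSum.tendsto_sum_nat.comp (t k hk)
  have h2 := (summable_dis_logDiff one_pos).hasSum.tendsto_sum_nat.comp (t 1 one_pos)
  have h3 := h1.sub h2
  simp only [Function.comp_def, sum_dis_logDiff hk] at h3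
  have := tendsto_nhds_unique h3 tendsto_const_nhds
  linarith

/-- Split `rowSum` into `2 * logDiff` and a remainder. The first part gives exactly `4 log k` plus a
constant. Since `k * dis k n ≤ n`, the remainder is dominated by `5/n²` and converges termwise, as
`k * dis k n = n` for `k ≥ n`. -/
theorem exists_tendsto_stripeDipole :
    ∃ c : ℝ, Tendsto (fun k : ℕ => k * stripeDipole k - 4 * Real.log k) atTop (𝓝 c) := by
  have hlim : Tendsto
      (fun k : ℕ => ∑' n : ℕ, (k : ℝ) * dis k n * (rowSum n - 2 * logDiff n)) atTop
      (𝓝 (∑' n : ℕ, (n : ℝ) * (rowSum n - 2 * logDiff n))) := by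
    refine tendsto_tsum_of_dominated_convergence summable_five_div_sq (fun n => ?_) ?_
    · refine tendsto_const_nhds.congr' ?_
      filter_upwards [eventually_ge_atTop n, eventually_gt_atTop 0] with k hk hk0
      have hk' : (k : ℝ) ≠ 0 := by positivity
      rw [dis_natCast hk0 hk]
      field_simp
    · filter_upwards [eventually_gt_atTop 0] with k hk n
      exact abs_dis_mul_le hk n
  refine ⟨_, ((hlim.const_mul 2).add_const
    (4 * ∑' n : ℕ, ((1 : ℕ) : ℝ) * dis 1 n * logDiff n)).congr' ?_⟩
  filter_upwards [eventually_gt_atTop 0] with k hk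
  have e : ∑' n : ℕ, dis k n * rowSum n * k
      = ∑' n : ℕ, (k : ℝ) * dis k n * (rowSum n - 2 * logDiff n)
        + 2 * ∑' n : ℕ, (k : ℝ) * dis k n * logDiff n := by
    rw [← tsum_mul_left, ← (summable_dis_remainder hk).tsum_add
      ((summable_dis_logDiff hk).mul_left 2)]
    exact tsum_congr fun n => by ring
  rw [tsum_mul_right, tsum_dis_logDiff hk] at e
  rw [stripeDipole_eq hk]
  linarith

/-! ### The interaction of a row segment with a site -/

/-- The potential `1 / v - 1 / √(c² + v²)`, the integral of `u / (u² + v²)^{3/2}` over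
`0 < u < c`. -/
def segment (c v : ℝ) : ℝ := 1 / v - 1 / √(c ^ 2 + v ^ 2)

theorem segment_mono_left {c d v : ℝ} (hc : 0 ≤ c) (hcd : c ≤ d) (hv : 0 < v) :
    segment c v ≤ segment d v := by
  unfold segment
  gcongr

/-- With `a ≤ b` the two square roots, `m + 1/2 = (b² - a²)/2`, and the claim reduces to `2a² ≤ b(a
+ b)`. The shift by `1/2` costs at most half a row sum in total. -/
theorem sub_le_mul_ker {n : ℕ} (hn : 0 < n) (m : ℕ) :
    1 / √((m : ℝ) ^ 2 + (n : ℝ) ^ 2) - 1 / √((m + 1 : ℝ) ^ 2 + (n : ℝ) ^ 2)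
      ≤ (m + 1 / 2) * ker m n := by
  have hn' : (0 : ℝ) < n := by positivity
  have ha2 : (0 : ℝ) < (m : ℝ) ^ 2 + (n : ℝ) ^ 2 := by positivity
  have hb2 : (0 : ℝ) < (m + 1 : ℝ) ^ 2 + (n : ℝ) ^ 2 := by positivity
  have hsa := Real.sq_sqrt ha2.le
  have hsb := Real.sq_sqrt hb2.le
  have ha : 0 < √((m : ℝ) ^ 2 + (n : ℝ) ^ 2) := Real.sqrt_pos.2 ha2
  have hb : 0 < √((m + 1 : ℝ) ^ 2 + (n : ℝ) ^ 2) := Real.sqrt_pos.2 hb2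
  have hab : √((m : ℝ) ^ 2 + (n : ℝ) ^ 2) ≤ √((m + 1 : ℝ) ^ 2 + (n : ℝ) ^ 2) := by
    gcongr; linarith
  rw [ker_eq]
  push_cast
  set a := √((m : ℝ) ^ 2 + (n : ℝ) ^ 2)
  set b := √((m + 1 : ℝ) ^ 2 + (n : ℝ) ^ 2)
  have e : (m : ℝ) + 1 / 2 = (b - a) * (b + a) / 2 := by nlinarith
  have key : (m + 1 / 2) * (1 / a ^ 3) - (1 / a - 1 / b)
      = (b - a) * (b * (b + a) - 2 * a ^ 2) / (2 * a ^ 3 * b) := by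
    rw [e]; field_simp
  have : 0 ≤ (b - a) * (b * (b + a) - 2 * a ^ 2) / (2 * a ^ 3 * b) :=
    div_nonneg (mul_nonneg (by linarith) (by nlinarith)) (by positivity)
  linarith

theorem sum_ker_le_rowSum (n c : ℕ) : ∑ m ∈ Finset.range c, ker m n ≤ rowSum n := by
  have hs := summable_ker_nat n
  have h1 := hs.sum_le_tsum (Finset.range c) fun m _ => ker_nonneg _ _
  have h2 := hs.le_tsum 0 fun m _ => ker_nonneg _ _
  rw [Nat.cast_zero, ker_zero] at h2
  rw [rowSum_eq]
  linarith

theorem segment_le_sum {n : ℕ} (hn : 0 < n) (c : ℕ) :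
    segment ((c + 1 : ℕ) : ℝ) n - 1 / 2 * rowSum n
      ≤ ∑ m ∈ Finset.range (c + 1), (m : ℝ) * ker m n := by
  have hn' : (0 : ℝ) < n := by positivity
  set r : ℕ → ℝ := fun m => 1 / √((m : ℝ) ^ 2 + (n : ℝ) ^ 2) with hr
  have h0 : r 0 = 1 / n := by simp [hr]
  have h1 : ∑ m ∈ Finset.range (c + 1), (r m - r (m + 1)) = segment ((c + 1 : ℕ) : ℝ) n := by
    rw [Finset.sum_range_sub', h0, segment]
  have h2 : ∑ m ∈ Finset.range (c + 1), (r m - r (m + 1))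
      ≤ ∑ m ∈ Finset.range (c + 1), ((m : ℝ) * ker m n + 1 / 2 * ker m n) :=
    Finset.sum_le_sum fun m _ => by
      have := sub_le_mul_ker hn m
      simp only [hr]
      push_cast
      linarith
  rw [Finset.sum_add_distrib, ← Finset.mul_sum, h1] at h2
  have := sum_ker_le_rowSum n (c + 1)
  linarith

/-- The tent `h * dis h` dominates the mean of two truncated ramps, `m` on `[0, h]` and `m` on `[0,
4h/3]`: beyond `h` the condition is `2h - m ≥ m/2`, that is `m ≤ 4h/3`. The ramp on `[0, h]` alone
would lose the `2 log(4/3)` that makes the final constant positive. -/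
theorem segment_le_halfRow {h n : ℕ} (hh : 0 < h) (hn : 0 < n) :
    1 / 2 * segment h n + 1 / 2 * segment (4 * h / 3) n
      ≤ h * halfRow h n + 1 / 2 * rowSum n := by
  have hn' : (0 : ℝ) < n := by positivity
  have hh' : (0 : ℝ) < h := by positivity
  set c := 4 * h / 3 with hc
  have hhc : h ≤ c := by omega
  have s1 := segment_le_sum hn h
  have s2 := segment_le_sum hn c
  have t1 : segment h n ≤ segment ((h + 1 : ℕ) : ℝ) n :=
    segment_mono_left hh'.le (by push_cast; linarith) hn'
  have t2 : segment (4 * h / 3) n ≤ segment ((c + 1 : ℕ) : ℝ) n := by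
    refine segment_mono_left (by positivity) ?_ hn'
    have : 4 * h ≤ 3 * (c + 1) := by omega
    have : (4 * h : ℝ) ≤ 3 * ((c + 1 : ℕ) : ℝ) := by exact_mod_cast this
    linarith
  have hsum : ∑ m ∈ Finset.range (c + 1), (h : ℝ) * (dis h m * ker m n) ≤ h * halfRow h n := by
    rw [← Finset.mul_sum]
    refine mul_le_mul_of_nonneg_left ?_ hh'.le
    exact ((summable_dis_ker hh n).comp_injective Nat.cast_injective).sum_le_tsum _ fun m _ =>
      mul_nonneg (dis_nonneg hh _) (ker_nonneg _ _)
  have hpt : 1 / 2 * ∑ m ∈ Finset.range (h + 1), (m : ℝ) * ker m n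
      + 1 / 2 * ∑ m ∈ Finset.range (c + 1), (m : ℝ) * ker m n
      ≤ ∑ m ∈ Finset.range (c + 1), (h : ℝ) * (dis h m * ker m n) := by
    obtain ⟨d, hd⟩ := Nat.exists_eq_add_of_le hhc
    rw [show c + 1 = (h + 1) + d by omega, Finset.sum_range_add _ (h + 1) d,
      Finset.sum_range_add _ (h + 1) d, mul_add, ← add_assoc, ← add_mul, Finset.mul_sum, Finset.mul_sum]
    refine add_le_add (Finset.sum_le_sum fun m hm => ?_) (Finset.sum_le_sum fun m hm => ?_)
    · rw [dis_natCast hh (by have := Finset.mem_range.1 hm; omega)]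
      apply le_of_eq
      field_simp
      norm_num
    · have hm' := Finset.mem_range.1 hm
      have e := dis_block' hh 0 (s := m + 1) (by omega)
      rw [show 0 * (2 * h) + (h + (m + 1)) = h + 1 + m by ring] at e
      rw [← mul_assoc, ← mul_assoc, e]
      refine mul_le_mul_of_nonneg_right ?_ (ker_nonneg _ _)
      have : 3 * (h + 1 + m) ≤ 4 * h := by omega
      have : (3 * (h + 1 + m) : ℝ) ≤ 4 * h := by exact_mod_cast this
      push_cast
      linarith
  linarith

/-! ### Convexity of the segment potential -/

theorem hasDerivAt_segment (c : ℝ) {v : ℝ} (hv : 0 < v) :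
    HasDerivAt (segment c) (-1 / v ^ 2 + v / √(c ^ 2 + v ^ 2) ^ 3) v := by
  have hp : 0 < c ^ 2 + v ^ 2 := by positivity
  have hs : 0 < √(c ^ 2 + v ^ 2) := Real.sqrt_pos.2 hp
  have h1 : HasDerivAt (fun v : ℝ => c ^ 2 + v ^ 2) (2 * v) v := by
    simpa using (hasDerivAt_pow 2 v).const_add (c ^ 2)
  have h2 := (hasDerivAt_inv hv.ne').sub ((h1.sqrt hp.ne').inv hs.ne')
  have e : segment c = (fun v : ℝ => v⁻¹) - (fun v => √(c ^ 2 + v ^ 2))⁻¹ := by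
    funext v; simp [segment]
  rw [e]
  refine h2.congr_deriv ?_
  field_simp
  ring

theorem hasDerivAt_segment_deriv (c : ℝ) {v : ℝ} (hv : 0 < v) :
    HasDerivAt (fun v => -1 / v ^ 2 + v / √(c ^ 2 + v ^ 2) ^ 3)
      (2 / v ^ 3 + 1 / √(c ^ 2 + v ^ 2) ^ 3 - 3 * v ^ 2 / √(c ^ 2 + v ^ 2) ^ 5) v := by
  have hp : 0 < c ^ 2 + v ^ 2 := by positivity
  have hs : 0 < √(c ^ 2 + v ^ 2) := Real.sqrt_pos.2 hp
  have h1 : HasDerivAt (fun v : ℝ => c ^ 2 + v ^ 2) (2 * v) v := by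
    simpa using (hasDerivAt_pow 2 v).const_add (c ^ 2)
  have h2 := (hasDerivAt_id v).div ((h1.sqrt hp.ne').pow 3) (pow_pos hs 3).ne'
  have h3 := (hasDerivAt_const v (-1 : ℝ)).div (hasDerivAt_pow 2 v) (by positivity)
  refine (h3.add h2).congr_deriv ?_
  simp only [id, Pi.pow_apply]
  field_simp
  ring

theorem convexOn_segment (c : ℝ) : ConvexOn ℝ (Set.Ioi 0) (segment c) := by
  refine convexOn_of_hasDerivWithinAt2_nonneg (convex_Ioi 0)
    (fun v hv => (hasDerivAt_segment c hv).continuousAt.continuousWithinAt)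
    (f' := fun v => -1 / v ^ 2 + v / √(c ^ 2 + v ^ 2) ^ 3)
    (f'' := fun v => 2 / v ^ 3 + 1 / √(c ^ 2 + v ^ 2) ^ 3 - 3 * v ^ 2 / √(c ^ 2 + v ^ 2) ^ 5)
    ?_ ?_ ?_
  · intro v hv
    rw [interior_Ioi] at hv
    exact (hasDerivAt_segment c hv).hasDerivWithinAt
  · intro v hv
    rw [interior_Ioi] at hv
    exact (hasDerivAt_segment_deriv c hv).hasDerivWithinAt
  · intro v hv
    rw [interior_Ioi] at hv
    have hv' : 0 < v := hv
    have hvr : v ≤ √(c ^ 2 + v ^ 2) := Real.le_sqrt_of_sq_le (by nlinarith [sq_nonneg c])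
    set r := √(c ^ 2 + v ^ 2)
    have hr : 0 < r := lt_of_lt_of_le hv' hvr
    have e1 : 3 * v ^ 2 / r ^ 5 ≤ 3 * r ^ 2 / r ^ 5 := by gcongr
    have e2 : 3 * r ^ 2 / r ^ 5 = 3 * (1 / r ^ 3) := by field_simp
    have e3 : 1 / r ^ 3 ≤ 1 / v ^ 3 := by gcongr
    have e4 : 2 / v ^ 3 = 2 * (1 / v ^ 3) := by ring
    linarith

theorem segment_antitoneOn (c : ℝ) : AntitoneOn (segment c) (Set.Ioi 0) := by
  refine antitoneOn_of_hasDerivWithinAt_nonpos (convex_Ioi 0)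
    (fun v hv => (hasDerivAt_segment c hv).continuousAt.continuousWithinAt)
    (f' := fun v => -1 / v ^ 2 + v / √(c ^ 2 + v ^ 2) ^ 3) ?_ ?_
  · intro v hv
    rw [interior_Ioi] at hv
    exact (hasDerivAt_segment c hv).hasDerivWithinAt
  · intro v hv
    rw [interior_Ioi] at hv
    have hv' : 0 < v := hv
    have hvr : v ≤ √(c ^ 2 + v ^ 2) := Real.le_sqrt_of_sq_le (by nlinarith [sq_nonneg c])
    set r := √(c ^ 2 + v ^ 2)
    have hr : 0 < r := lt_of_lt_of_le hv' hvr
    have e1 : v / r ^ 3 ≤ v / v ^ 3 := by gcongr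
    have e2 : v / v ^ 3 = 1 / v ^ 2 := by field_simp
    have e3 : -1 / v ^ 2 = -(1 / v ^ 2) := by ring
    linarith

/-- Each of `x ± s` is a convex combination of `x ± t`, with weights `(t ± s)/(2t)` interchanged. -/
theorem convexOn_add_symm_le {f : ℝ → ℝ} {S : Set ℝ} (hf : ConvexOn ℝ S f) {x s t : ℝ}
    (hs : 0 ≤ s) (hst : s ≤ t) (h1 : x - t ∈ S) (h2 : x + t ∈ S) :
    f (x - s) + f (x + s) ≤ f (x - t) + f (x + t) := by
  rcases hs.eq_or_lt with rfl | hs'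
  · rcases hst.eq_or_lt with rfl | ht
    · exact le_rfl
    · have := hf.2 h1 h2 (by norm_num : (0 : ℝ) ≤ 1 / 2) (by norm_num : (0 : ℝ) ≤ 1 / 2)
        (by norm_num)
      rw [show (1 / 2 : ℝ) • (x - t) + (1 / 2 : ℝ) • (x + t) = x by simp; ring] at this
      simp only [smul_eq_mul] at this
      simp only [sub_zero, add_zero]
      linarith
  have ht : 0 < t := lt_of_lt_of_le hs' hst
  have a1 : 0 ≤ (t + s) / (2 * t) := by positivity
  have a2 : 0 ≤ (t - s) / (2 * t) := div_nonneg (by linarith) (by positivity)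
  have a3 : (t + s) / (2 * t) + (t - s) / (2 * t) = 1 := by field_simp; ring
  have e1 := hf.2 h1 h2 a1 a2 a3
  have e2 := hf.2 h1 h2 a2 a1 (by linarith)
  rw [show ((t + s) / (2 * t)) • (x - t) + ((t - s) / (2 * t)) • (x + t) = x - s by
    simp only [smul_eq_mul]; field_simp; ring] at e1
  rw [show ((t - s) / (2 * t)) • (x - t) + ((t + s) / (2 * t)) • (x + t) = x + s by
    simp only [smul_eq_mul]; field_simp; ring] at e2
  simp only [smul_eq_mul] at e1 e2
  have e3 : ∀ y : ℝ, (t + s) / (2 * t) * y + (t - s) / (2 * t) * y = y := fun y => by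
    rw [← add_mul, a3, one_mul]
  have := e3 (f (x - t))
  have := e3 (f (x + t))
  linarith

/-- Chebyshev's argument: the weight is odd under `s ↦ k - s`, so pairing `s` with `k - s` leaves
products of factors of equal sign. -/
theorem sum_antisymm_mul_nonneg {k : ℕ} {g : ℕ → ℝ} (hg : ∀ s t, s ≤ t → t ≤ k → g s ≤ g t) :
    0 ≤ ∑ s ∈ Finset.range (k + 1), (2 * (s : ℝ) - k) * g s := by
  have h1 := Finset.sum_range_reflect (fun s : ℕ => (2 * (s : ℝ) - k) * g s) (k + 1)
  have h2 : 0 ≤ ∑ s ∈ Finset.range (k + 1), (2 * (s : ℝ) - k) * (g s - g (k - s)) := by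
    refine Finset.sum_nonneg fun s hs => ?_
    have hs' : s ≤ k := Nat.lt_succ_iff.1 (Finset.mem_range.1 hs)
    rcases le_total (2 * s) k with h | h
    · have : (2 * s : ℝ) ≤ k := by exact_mod_cast h
      exact mul_nonneg_of_nonpos_of_nonpos (by linarith)
        (sub_nonpos.2 (hg _ _ (by omega) (by omega)))
    · have : (k : ℝ) ≤ 2 * s := by exact_mod_cast h
      exact mul_nonneg (by linarith) (sub_nonneg.2 (hg _ _ (by omega) (by omega)))
  have h3 : ∑ s ∈ Finset.range (k + 1), (2 * (s : ℝ) - k) * g (k - s)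
      = -∑ s ∈ Finset.range (k + 1), (2 * (s : ℝ) - k) * g s := by
    rw [← h1, ← Finset.sum_neg_distrib]
    refine Finset.sum_congr rfl fun s hs => ?_
    have hs' : s ≤ k := Nat.lt_succ_iff.1 (Finset.mem_range.1 hs)
    rw [show k + 1 - 1 - s = k - s by omega, Nat.cast_sub hs']
    ring
  simp only [mul_sub, Finset.sum_sub_distrib] at h2 h3
  linarith

/-- On the period centred at the zero `x` of the triangle wave, the wave minus its mean is even
about `x`, negative near it and positive near the ends, so it pairs nonnegatively with a convex
function. -/
theorem sum_wave_mul_nonneg {f : ℝ → ℝ} (hf : ConvexOn ℝ (Set.Ioi 0) f)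
    (ha : AntitoneOn f (Set.Ioi 0)) (k : ℕ) {x : ℝ} (hx : (k : ℝ) < x) :
    0 ≤ ∑ s ∈ Finset.range k, ((k : ℝ) - 2 * s) * f (x - k + s)
      + ∑ s ∈ Finset.range k, (2 * (s : ℝ) - k) * f (x + s) := by
  have hk : (0 : ℝ) ≤ k := by positivity
  have h1 := sum_antisymm_mul_nonneg (k := k) (g := fun s : ℕ => f (x - s) + f (x + s))
    fun s t hst htk => by
      have : (s : ℝ) ≤ t := by exact_mod_cast hst
      have : (t : ℝ) ≤ k := by exact_mod_cast htk
      exact convexOn_add_symm_le hf (by positivity) (by assumption)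
        (show (0 : ℝ) < x - t by linarith) (show (0 : ℝ) < x + t by linarith)
  have h2 := Finset.sum_range_reflect (fun s : ℕ => (2 * (s : ℝ) - k) * f (x - s)) (k + 1)
  have h3 : ∑ s ∈ Finset.range (k + 1), (2 * (s : ℝ) - k) * f (x - s)
      = ∑ s ∈ Finset.range (k + 1), ((k : ℝ) - 2 * s) * f (x - k + s) := by
    rw [← h2]
    refine Finset.sum_congr rfl fun s hs => ?_
    have hs' : s ≤ k := Nat.lt_succ_iff.1 (Finset.mem_range.1 hs)
    rw [show k + 1 - 1 - s = k - s by omega, Nat.cast_sub hs', sub_sub_eq_add_sub, sub_add_eq_add_sub]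
    ring
  simp only [mul_add, Finset.sum_add_distrib] at h1
  rw [h3, Finset.sum_range_succ, Finset.sum_range_succ] at h1
  -- The symmetric sum counts `x` twice and includes the right end `x + k`. Passing to the half-open
  -- period discards `k * (f (x + k) - f x)`, which is nonpositive.
  have h4 : f (x + k) ≤ f x := ha (show (0 : ℝ) < x by linarith) (show (0 : ℝ) < x + k by linarith)
    (by linarith)
  rw [sub_add_cancel] at h1
  nlinarith

/-- From `k` on, the triangle wave may be replaced by its mean `1/2`: the periods `[k, 3k)`, `[3k,
5k)`, ... begin at maxima of the wave. -/
theorem half_sum_le_sum_dis {f : ℝ → ℝ} (hf : ConvexOn ℝ (Set.Ioi 0) f)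
    (ha : AntitoneOn f (Set.Ioi 0)) {k : ℕ} (hk : 0 < k) (j : ℕ) :
    ∑ n ∈ Finset.range k, dis k n * f n
        + 1 / 2 * ∑ i ∈ Finset.range (j * (2 * k)), f ((k + i : ℕ) : ℝ)
      ≤ ∑ n ∈ Finset.range (k + j * (2 * k)), dis k n * f n := by
  have hk' : (0 : ℝ) < k := by positivity
  rw [Finset.sum_range_add]
  refine add_le_add le_rfl ?_
  induction j with
  | zero => simp
  | succ j ih =>
    rw [add_mul j, one_mul, Finset.sum_range_add, Finset.sum_range_add, mul_add]
    refine add_le_add ih ?_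
    rw [two_mul k, Finset.sum_range_add, Finset.sum_range_add, ← two_mul k]
    have key := sum_wave_mul_nonneg hf ha k (x := k + j * (2 * k) + k) (by
      have : (0 : ℝ) ≤ j * (2 * k) := by positivity
      linarith)
    have e1 : ∀ s ∈ Finset.range k, (k : ℝ) * (dis k ((k + (j * (2 * k) + s) : ℕ) : ℤ)
        * f ((k + (j * (2 * k) + s) : ℕ) : ℝ)) = (k - s) * f (k + j * (2 * k) + k - k + s) :=
      fun s hs => by
        rw [← mul_assoc, show k + (j * (2 * k) + s) = j * (2 * k) + (k + s) by ring,
          dis_block' hk j (Finset.mem_range.1 hs).le]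
        congr 2; push_cast; ring
    have e2 : ∀ s ∈ Finset.range k, (k : ℝ) * (dis k ((k + (j * (2 * k) + (k + s)) : ℕ) : ℤ)
        * f ((k + (j * (2 * k) + (k + s)) : ℕ) : ℝ)) = s * f (k + j * (2 * k) + k + s) :=
      fun s hs => by
        rw [← mul_assoc, show k + (j * (2 * k) + (k + s)) = (j + 1) * (2 * k) + s by ring,
          dis_block hk (j + 1) (Finset.mem_range.1 hs).le]
        congr 2; push_cast; ring
    have e3 : ∀ s ∈ Finset.range k, f ((k + (j * (2 * k) + s) : ℕ) : ℝ)
        = f (k + j * (2 * k) + k - k + s) := fun s _ => by congr 1; push_cast; ring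
    have e4 : ∀ s ∈ Finset.range k, f ((k + (j * (2 * k) + (k + s)) : ℕ) : ℝ)
        = f (k + j * (2 * k) + k + s) := fun s _ => by congr 1; push_cast; ring
    have e5 := congrArg₂ (· + ·) (Finset.sum_congr rfl e1) (Finset.sum_congr rfl e2)
    simp only [← Finset.mul_sum, ← mul_add] at e5
    refine le_of_mul_le_mul_left ?_ hk'
    rw [e5, Finset.sum_congr rfl e3, Finset.sum_congr rfl e4]
    simp only [sub_mul, Finset.sum_sub_distrib, ← Finset.mul_sum, mul_assoc] at key ⊢
    linarith

/-! ### Sums of the segment potential -/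

theorem hasDerivAt_log_sub_arsinh {c v : ℝ} (hc : 0 < c) (hv : 0 < v) :
    HasDerivAt (fun v => Real.log v - Real.arsinh (v / c)) (segment c v) v := by
  have h := (Real.hasDerivAt_log hv.ne').sub (((hasDerivAt_id v).div_const c).arsinh)
  refine h.congr_deriv ?_
  have e : c ^ 2 + v ^ 2 = c ^ 2 * (1 + (v / c) ^ 2) := by field_simp
  have : 0 < √(1 + (v / c) ^ 2) := Real.sqrt_pos.2 (by positivity)
  rw [segment, e, Real.sqrt_mul (by positivity), Real.sqrt_sq hc.le]
  simp only [id, smul_eq_mul]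
  field_simp

theorem log_sub_arsinh_le_sum {c : ℝ} (hc : 0 < c) {k : ℕ} (hk : 0 < k) (m : ℕ) :
    Real.log ((k + m : ℕ) : ℝ) - Real.arsinh (((k + m : ℕ) : ℝ) / c)
        - (Real.log k - Real.arsinh (k / c))
      ≤ ∑ i ∈ Finset.range m, segment c ((k + i : ℕ) : ℝ) := by
  set F : ℕ → ℝ := fun i => Real.log ((k + i : ℕ) : ℝ) - Real.arsinh (((k + i : ℕ) : ℝ) / c)
  have h0 : F 0 = Real.log k - Real.arsinh (k / c) := rfl
  rw [← h0]
  change F m - F 0 ≤ _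
  rw [← Finset.sum_range_sub]
  refine Finset.sum_le_sum fun i _ => ?_
  have hpos : (0 : ℝ) < ((k + i : ℕ) : ℝ) := by positivity
  have hlt : ((k + i : ℕ) : ℝ) < ((k + (i + 1) : ℕ) : ℝ) := by push_cast; linarith
  obtain ⟨y, ⟨hy0, hy1⟩, hy⟩ := exists_hasDerivAt_eq_slope
    (fun v => Real.log v - Real.arsinh (v / c)) (segment c) hlt
    (fun x hx => (hasDerivAt_log_sub_arsinh hc
      (hpos.trans_le hx.1)).continuousAt.continuousWithinAt)
    (fun x hx => hasDerivAt_log_sub_arsinh hc (hpos.trans hx.1))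
  have hone : ((k + (i + 1) : ℕ) : ℝ) - ((k + i : ℕ) : ℝ) = 1 := by push_cast; ring
  rw [hone, div_one] at hy
  calc F (i + 1) - F i = segment c y := hy.symm
    _ ≤ segment c ((k + i : ℕ) : ℝ) := segment_antitoneOn c hpos (hpos.trans hy0) hy0.le

/-- Reflects `arsinh (v / c) = log (2v / c) + o(1)`. -/
theorem tendsto_log_sub_arsinh {c : ℝ} (hc : 0 < c) :
    Tendsto (fun v => Real.log v - Real.arsinh (v / c)) atTop (𝓝 (Real.log (c / 2))) := by
  have h1 : Tendsto (fun v : ℝ => -Real.log (1 / c + √(v⁻¹ ^ 2 + (1 / c) ^ 2))) atTop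
      (𝓝 (-Real.log (1 / c + √(0 ^ 2 + (1 / c) ^ 2)))) := by
    refine (Tendsto.log ?_ (by positivity)).neg
    exact (((tendsto_inv_atTop_zero.pow 2).add_const _).sqrt).const_add _
  have e : -Real.log (1 / c + √(0 ^ 2 + (1 / c) ^ 2)) = Real.log (c / 2) := by
    rw [← Real.log_inv, zero_pow two_ne_zero, zero_add, Real.sqrt_sq (by positivity)]
    congr 1
    field_simp
    norm_num
  rw [e] at h1
  refine h1.congr' ?_
  filter_upwards [eventually_gt_atTop 0] with v hv
  have e1 : 1 + (v / c) ^ 2 = v ^ 2 * (v⁻¹ ^ 2 + (1 / c) ^ 2) := by field_simp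
  have e2 : v / c + √(1 + (v / c) ^ 2) = v * (1 / c + √(v⁻¹ ^ 2 + (1 / c) ^ 2)) := by
    rw [e1, Real.sqrt_mul (by positivity), Real.sqrt_sq hv.le]; ring
  rw [Real.arsinh, e2, Real.log_mul hv.ne' (by positivity)]
  ring

theorem le_sum_dis_segment {c : ℝ} (hc : 0 < c) {k : ℕ} (hk : 0 < k) :
    (k - 1 - (√(c ^ 2 + (k : ℝ) ^ 2) - c)) / k
      ≤ ∑ n ∈ Finset.range k, dis k n * segment c n := by
  have hk' : (0 : ℝ) < k := by positivity
  set r : ℕ → ℝ := fun n => √(c ^ 2 + (n : ℝ) ^ 2) with hr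
  have hpos : ∀ n, 0 < r n := fun n => Real.sqrt_pos.2 (by positivity)
  have hr0 : r 0 = c := by simp [hr, Real.sqrt_sq hc.le]
  -- Compare squares: `(r n + n / r n)² ≤ (r n)² + 2n + 1 = (r (n + 1))²`.
  have h1 : ∀ n : ℕ, (n : ℝ) / r n ≤ r (n + 1) - r n := fun n => by
    have h2 : r n ^ 2 = c ^ 2 + (n : ℝ) ^ 2 := Real.sq_sqrt (by positivity)
    have h3 : r (n + 1) ^ 2 = c ^ 2 + ((n + 1 : ℕ) : ℝ) ^ 2 := Real.sq_sqrt (by positivity)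
    push_cast at h3
    have h4 : (n : ℝ) ≤ r n := Real.le_sqrt_of_sq_le (by nlinarith [sq_nonneg c])
    have h5 : (n : ℝ) / r n ≤ 1 := (div_le_one (hpos n)).2 h4
    have h6 : (n : ℝ) / r n * r n = n := div_mul_cancel₀ _ (hpos n).ne'
    have h7 : 0 ≤ (n : ℝ) / r n := div_nonneg (by positivity) (hpos n).le
    have h8 : r n + n / r n ≤ r (n + 1) :=
      le_of_sq_le_sq (by nlinarith) (hpos _).le
    linarith
  -- At `n = 0` the left side vanishes while `1 - n / r n` is `1`; the indicator corrects this and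
  -- produces the `-1` of the statement.
  have h2 : ∀ n ∈ Finset.range k, dis k n * segment c n
      = (1 - (n : ℝ) / r n - if n = 0 then 1 else 0) / k := fun n hn => by
    rw [dis_natCast hk (Finset.mem_range.1 hn).le]
    rcases Nat.eq_zero_or_pos n with rfl | hn0
    · simp
    · have hn' : (0 : ℝ) < n := by positivity
      rw [if_neg hn0.ne', segment]
      have := hpos n
      simp only [hr] at this ⊢
      field_simp
      ring
  rw [Finset.sum_congr rfl h2, ← Finset.sum_div]
  gcongr
  simp only [Finset.sum_sub_distrib]
  have h3 : ∑ n ∈ Finset.range k, (n : ℝ) / r n ≤ r k - c := by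
    rw [← hr0, ← Finset.sum_range_sub]
    exact Finset.sum_le_sum fun n _ => h1 n
  have h4 : ∑ n ∈ Finset.range k, (if n = 0 then (1 : ℝ) else 0) = 1 := by
    simp [Finset.sum_ite_eq', hk]
  rw [h4]
  simp only [Finset.sum_const, Finset.card_range, nsmul_eq_mul, mul_one]
  linarith

theorem sinh_le_mul_cosh {u : ℝ} (hu : 0 ≤ u) : Real.sinh u ≤ u * Real.cosh u := by
  have hd : ∀ x, HasDerivAt (fun x => x * Real.cosh x - Real.sinh x) (x * Real.sinh x) x :=
    fun x => (((hasDerivAt_id x).mul (Real.hasDerivAt_cosh x)).sub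
      (Real.hasDerivAt_sinh x)).congr_deriv (by simp)
  have hm : MonotoneOn (fun x => x * Real.cosh x - Real.sinh x) (Set.Ici 0) := by
    refine monotoneOn_of_hasDerivWithinAt_nonneg (convex_Ici 0)
      (fun x _ => (hd x).continuousAt.continuousWithinAt)
      (fun x _ => (hd x).hasDerivWithinAt) fun x hx => ?_
    rw [interior_Ici] at hx
    exact mul_nonneg (le_of_lt hx) (Real.sinh_nonneg_iff.2 (le_of_lt hx))
  have := hm (Set.self_mem_Ici) hu hu
  simp at this
  linarith

/-- With `x = sinh 2u` this is `4 sinh² u ≤ 4 u sinh u cosh u`, that is `tanh u ≤ u`. -/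
theorem two_mul_sqrt_sub_le {x : ℝ} (hx : 0 ≤ x) :
    2 * (√(1 + x ^ 2) - 1) ≤ x * Real.arsinh x := by
  obtain ⟨u, hu⟩ : ∃ u, Real.arsinh x = 2 * u := ⟨Real.arsinh x / 2, by ring⟩
  have hu0 : 0 ≤ u := by have := Real.arsinh_nonneg_iff.2 hx; linarith
  have h1 := Real.sinh_arsinh x
  have h2 := Real.cosh_arsinh x
  rw [hu] at h1 h2
  rw [← h2, hu, ← h1, Real.sinh_two_mul, Real.cosh_two_mul, Real.cosh_sq]
  have h3 := sinh_le_mul_cosh hu0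
  have h4 := Real.sinh_nonneg_iff.2 hu0
  nlinarith

/-! ### The corner energy -/

/-- With `x = k / c`, the terms beyond `log (c / k)` and constants are `arsinh x / 2 - (√(1 + x²) -
1) / x`, which is nonnegative. -/
theorem segment_bound {c : ℝ} (hc : 0 < c) {k : ℕ} (hk : 0 < k) :
    1 / 2 * (Real.log (c / k) + 2 - Real.log 2) - 1 / k
      ≤ (k - 1 - (√(c ^ 2 + (k : ℝ) ^ 2) - c)) / k
        + 1 / 2 * (Real.log (c / 2) - (Real.log k - Real.arsinh (k / c))) := by
  have hk' : (0 : ℝ) < k := by positivity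
  have h1 := two_mul_sqrt_sub_le (x := k / c) (by positivity)
  have e : c ^ 2 + (k : ℝ) ^ 2 = c ^ 2 * (1 + (k / c) ^ 2) := by field_simp
  rw [e, Real.sqrt_mul (by positivity), Real.sqrt_sq hc.le, Real.log_div hc.ne' hk'.ne',
    Real.log_div hc.ne' two_ne_zero]
  set q := √(1 + ((k : ℝ) / c) ^ 2)
  have h2 : (k - 1 - (c * q - c)) / k = 1 - 1 / k - c / k * (q - 1) := by field_simp
  have h3 : c / k * (2 * (q - 1)) ≤ c / k * (k / c * Real.arsinh (k / c)) := by gcongr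
  have h4 : c / k * (k / c * Real.arsinh (k / c)) = Real.arsinh (k / c) := by field_simp
  rw [h2]
  linarith

/-- Sum `segment_le_halfRow` against `dis k`: the exact ramp is kept below `k`, the mean `1/2` is
used beyond it, and the partial sums are sent to infinity. Averaging `log c` over `c = h` and `c =
4h/3` yields the term in `log (4/3)`; the row sums account for `-2 * stripeDipole k`. -/
theorem le_cornerDipole {h k : ℕ} (hh : 0 < h) (hk : 0 < k) :
    4 * Real.log (h / k) + 2 * Real.log (4 / 3) + 8 - 4 * Real.log 2 - 8 / k
        - 2 * stripeDipole k ≤ 2 * (h * cornerDipole h k) := by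
  have hk' : (0 : ℝ) < k := by positivity
  have hh' : (0 : ℝ) < h := by positivity
  have s1 : Summable fun n : ℕ => dis k n * halfRow h n :=
    (summable_dis_halfRow hh hk).comp_injective Nat.cast_injective
  have s2 := summable_dis_rowSum_nat hk
  have s3 := (s1.mul_left (h : ℝ)).add (s2.mul_left (1 / 2))
  set T := ∑' n : ℕ, ((h : ℝ) * (dis k n * halfRow h n) + 1 / 2 * (dis k n * rowSum n)) with hT
  have hTe : T = h * (cornerDipole h k / 4) + 1 / 2 * (stripeDipole k / 2) := by
    rw [hT, (s1.mul_left (h : ℝ)).tsum_add (s2.mul_left (1 / 2)), tsum_mul_left, tsum_mul_left,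
      cornerDipole_eq hh hk, stripeDipole_eq hk]
    ring
  have hnn : ∀ n : ℕ, 0 ≤ (h : ℝ) * (dis k n * halfRow h n) + 1 / 2 * (dis k n * rowSum n) :=
    fun n => by
      have := dis_nonneg hk n
      have := halfRow_nonneg hh n
      have := rowSum_nonneg n
      positivity
  have hc2 : (0 : ℝ) < 4 * h / 3 := by positivity
  set F : ℝ → ℝ → ℝ := fun c v => Real.log v - Real.arsinh (v / c) with hF
  have part : ∀ c : ℝ, 0 < c → ∀ j : ℕ, (k - 1 - (√(c ^ 2 + (k : ℝ) ^ 2) - c)) / k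
      + 1 / 2 * (F c ((k + j * (2 * k) : ℕ) : ℝ) - F c k)
      ≤ ∑ n ∈ Finset.range (k + j * (2 * k)), dis k n * segment c n := fun c hc j => by
    have h1 := half_sum_le_sum_dis (convexOn_segment c) (segment_antitoneOn c) hk j
    have h2 := le_sum_dis_segment hc hk
    have h3 := log_sub_arsinh_le_sum hc hk (j * (2 * k))
    simp only [hF]
    linarith
  have hM : Tendsto (fun j : ℕ => ((k + j * (2 * k) : ℕ) : ℝ)) atTop atTop :=
    tendsto_natCast_atTop_atTop.comp (tendsto_atTop_mono
      (fun j => (Nat.le_mul_of_pos_right j (by omega)).trans (Nat.le_add_left _ _)) tendsto_id)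
  have lim : ∀ c : ℝ, 0 < c → Tendsto (fun j : ℕ => (k - 1 - (√(c ^ 2 + (k : ℝ) ^ 2) - c)) / k
      + 1 / 2 * (F c ((k + j * (2 * k) : ℕ) : ℝ) - F c k)) atTop
      (𝓝 ((k - 1 - (√(c ^ 2 + (k : ℝ) ^ 2) - c)) / k
        + 1 / 2 * (Real.log (c / 2) - F c k))) := fun c hc =>
    ((((tendsto_log_sub_arsinh hc).comp hM).sub_const _).const_mul _).const_add _
  have hle := le_of_tendsto (((lim h hh').const_mul (1 / 2)).add ((lim _ hc2).const_mul (1 / 2)))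
    (b := T) (Eventually.of_forall fun j => by
      refine le_trans ?_ (s3.sum_le_tsum (Finset.range (k + j * (2 * k))) fun n _ => hnn n)
      refine (add_le_add (mul_le_mul_of_nonneg_left (part h hh' j) (by norm_num))
        (mul_le_mul_of_nonneg_left (part _ hc2 j) (by norm_num))).trans ?_
      rw [Finset.mul_sum, Finset.mul_sum, ← Finset.sum_add_distrib]
      refine Finset.sum_le_sum fun n _ => ?_
      rcases Nat.eq_zero_or_pos n with rfl | hn
      · simp [dis_zero hk]
      · have := mul_le_mul_of_nonneg_left (segment_le_halfRow hh hn) (dis_nonneg hk n)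
        linarith)
  have b1 := segment_bound hh' hk
  have b2 := segment_bound hc2 hk
  have e : Real.log (4 * h / 3 / k) = Real.log (4 / 3) + Real.log (h / k) := by
    rw [← Real.log_mul (by norm_num) (by positivity)]; congr 1; ring
  rw [e] at b2
  have e8 : (8 : ℝ) / k = 8 * (1 / k) := by ring
  rw [e8]
  simp only [hF] at hle
  linarith

/-! ### Comparison of checkerboards and stripes -/

theorem tendsto_stripeDipole : Tendsto stripeDipole atTop (𝓝 0) := by
  obtain ⟨c, hc⟩ := exists_tendsto_stripeDipole
  have hlog : Tendsto (fun k : ℕ => Real.log k / (k : ℝ)) atTop (𝓝 0) := by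
    have := (Real.tendsto_pow_log_div_mul_add_atTop 1 0 1 one_ne_zero).comp
      tendsto_natCast_atTop_atTop
    simpa [Function.comp_def] using this
  have h := (hc.mul tendsto_inv_atTop_nhds_zero_nat).add (hlog.const_mul 4)
  simp only [mul_zero, add_zero] at h
  refine h.congr' ?_
  filter_upwards [eventually_gt_atTop 0] with k hk
  have hk' : (k : ℝ) ≠ 0 := by positivity
  field_simp
  ring

theorem lambdaMin_pos : 0 < lambdaMin := by
  have := deltaStar_spec.1.1
  unfold lambdaMin
  positivity

theorem cMin_pos : 0 < cMin := by
  unfold cMin cIII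
  positivity

/-- The graph of the concave logarithm lies above its chord from `1/2` to `1`. -/
theorem neg_two_log_two_mul_le_log {lam : ℝ} (h0 : 0 ≤ lam) (h1 : lam ≤ 1 / 2) :
    -(2 * Real.log 2) * lam ≤ Real.log (1 - lam) := by
  have h := strictConcaveOn_log_Ioi.concaveOn.2 (show (1 : ℝ) ∈ Set.Ioi 0 by norm_num)
    (show (2 : ℝ)⁻¹ ∈ Set.Ioi 0 by norm_num) (show 0 ≤ 1 - 2 * lam by linarith)
    (show 0 ≤ 2 * lam by linarith) (by ring)
  simp only [smul_eq_mul, Real.log_one, Real.log_inv, mul_zero, zero_add] at h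
  rw [show (1 - 2 * lam) * 1 + 2 * lam * 2⁻¹ = 1 - lam by ring] at h
  linarith

/-- The true value is about `0.26`; the estimate uses `3^5 ≤ 2^8`. -/
theorem corner_constant_pos :
    1 / 5 ≤ 2 * Real.log (4 / 3) + 8 - 4 * Real.log 2 - 8 * Real.log 2 := by
  have h3 : 5 * Real.log 3 ≤ 8 * Real.log 2 := by
    have : Real.log ((3 : ℝ) ^ 5) ≤ Real.log (2 ^ 8) :=
      Real.log_le_log (by norm_num) (by norm_num)
    rw [Real.log_pow, Real.log_pow] at this
    exact_mod_cast this
  have h4 : Real.log (4 / 3) = 2 * Real.log 2 - Real.log 3 := by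
    rw [Real.log_div (by norm_num) (by norm_num), show (4 : ℝ) = 2 ^ 2 by norm_num, Real.log_pow]
    push_cast
    ring
  have := Real.log_two_lt_d9
  rw [h4]
  linarith

theorem eventually_two_mul_le {a b : ℝ} (ha : 0 < a) (hb : 0 ≤ b) :
    ∀ᶠ J : ℝ in atTop, 2 * J + b ≤ a * Real.exp (J / 2) := by
  have h := (Real.tendsto_exp_div_pow_atTop 1).comp
    (tendsto_id.atTop_div_const (zero_lt_two' ℝ))
  filter_upwards [h.eventually_ge_atTop ((4 + 2 * b) / a), eventually_ge_atTop 1] with J hJ hJ1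
  simp only [Function.comp_apply, id, pow_one] at hJ
  rw [div_le_div_iff₀ ha (by linarith)] at hJ
  nlinarith

/-- The comparison with all errors measured by `η`. They come from the three stripe asymptotics,
from the rounding of `h` to `N` in the exchange term and in the logarithm, and from the corner
bound; together they stay below `5 * η`. -/
theorem stripeEnergy_lt_checkerboardEnergy {J h lam c η : ℝ} {N h₁ h₂ : ℕ} (hJ : 0 < J)
    (hN : 0 < N) (hNh : (N : ℝ) ≤ h) (hhN : h ≤ N + 1) (hlam : 0 < lam) (hlam2 : lam ≤ 1 / 2)
    (e₁ : (h₁ : ℝ) = h / lam) (e₂ : (h₂ : ℝ) = h / (1 - lam))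
    (hη : 5 * η < 1 / 5 * lam) (hJN : 2 * J / N ≤ η) (hN4 : 4 / N ≤ η)
    (hfN : 4 * Real.log N + c - η ≤ N * stripeDipole N)
    (hf₁ : h₁ * stripeDipole h₁ ≤ 4 * Real.log h₁ + c + η)
    (hf₂ : h₂ * stripeDipole h₂ ≤ 4 * Real.log h₂ + c + η)
    (hs₂ : 8 / h₂ + 2 * stripeDipole h₂ ≤ η) :
    stripeEnergy J N < checkerboardEnergy J h₁ h₂ := by
  have hN' : (0 : ℝ) < N := by positivity
  have hh : 0 < h := hN'.trans_le hNh
  have hmu : 0 < 1 - lam := by linarith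
  have hh₁ : 0 < h₁ := by
    have : (0 : ℝ) < h₁ := by rw [e₁]; positivity
    exact_mod_cast this
  have hh₂ : 0 < h₂ := by
    have : (0 : ℝ) < h₂ := by rw [e₂]; positivity
    exact_mod_cast this
  have hh₁' : (0 : ℝ) < h₁ := by positivity
  have hh₂' : (0 : ℝ) < h₂ := by positivity
  have m₁ : h = lam * h₁ := by rw [e₁]; field_simp
  have m₂ : h = (1 - lam) * h₂ := by rw [e₂]; field_simp
  rw [stripeEnergy_eq J hN, checkerboardEnergy_eq J hh₁ hh₂]
  have hinv : (1 : ℝ) / h₁ + 1 / h₂ = 1 / h := by rw [e₁, e₂]; field_simp; ring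
  rw [hinv]
  refine lt_of_mul_lt_mul_left ?_ hh.le
  have hc := le_cornerDipole hh₁ hh₂
  rw [Real.log_div hh₁'.ne' hh₂'.ne'] at hc
  have l₂ : Real.log h₂ = Real.log h - Real.log (1 - lam) := by
    rw [e₂, Real.log_div hh.ne' hmu.ne']
  have lN : Real.log h - 1 / N ≤ Real.log N := by
    have h1 := Real.log_le_sub_one_of_pos (div_pos hh hN')
    rw [Real.log_div hh.ne' hN'.ne'] at h1
    have h2 : h / N ≤ 1 + 1 / N := by
      rw [div_le_iff₀ hN', add_mul, div_mul_cancel₀ _ hN'.ne', one_mul]; exact hhN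
    linarith
  have q₁ : h * stripeDipole h₁ ≤ lam * (4 * Real.log h₁ + c + η) := by
    rw [m₁, mul_assoc]; gcongr
  have q₂ : h * stripeDipole h₂ ≤ (1 - lam) * (4 * Real.log h₂ + c + η) := by
    rw [m₂, mul_assoc]; gcongr
  have q₃ : lam * (4 * (Real.log h₁ - Real.log h₂) + 2 * Real.log (4 / 3) + 8 - 4 * Real.log 2 - η)
      ≤ h * (2 * cornerDipole h₁ h₂) := by
    calc _ ≤ lam * (2 * (h₁ * cornerDipole h₁ h₂)) := by
            refine mul_le_mul_of_nonneg_left ?_ hlam.le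
            linarith
      _ = h * (2 * cornerDipole h₁ h₂) := by rw [m₁]; ring
  have q₄ : N * stripeDipole N ≤ h * stripeDipole N :=
    mul_le_mul_of_nonneg_right hNh (stripeDipole_nonneg hN)
  have q₅ : h * (2 * J / N) ≤ 2 * J + 2 * J / N := by
    calc h * (2 * J / N) ≤ (N + 1) * (2 * J / N) := by gcongr
      _ = 2 * J + 2 * J / N := by field_simp
  have q₆ : h * (2 * J * (1 / h)) = 2 * J := by field_simp
  have q₇ := neg_two_log_two_mul_le_log hlam.le hlam2
  have q₈ := mul_le_mul_of_nonneg_left corner_constant_pos hlam.le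
  have q₉ : 4 * (1 / (N : ℝ)) ≤ η := by rwa [mul_one_div]
  have hη0 : 0 ≤ η := le_trans (by positivity) hN4
  have q₀ : lam * η ≤ 1 / 2 * η := by gcongr
  simp only [mul_sub, mul_add]
  rw [q₆]
  rw [l₂] at q₂ q₃
  nlinarith

end

end DipolarIsing

/-! ### Choice of the threshold for `J` -/

theorem lemma6 :
    ∃ Jmin : ℝ, 1 < Jmin ∧
      ∀ (J h lam : ℝ) (h₁ h₂ : ℕ), Jmin < J →
        DipolarIsing.cMin * Real.exp (J / 2) ≤ h → h ≤ DipolarIsing.cMax * Real.exp (J / 2) →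
        DipolarIsing.lambdaMin ≤ lam → lam ≤ 1 / 2 →
        (h₁ : ℝ) = h / lam → (h₂ : ℝ) = h / (1 - lam) →
        DipolarIsing.stripeEnergy J ⌊h⌋₊ < DipolarIsing.checkerboardEnergy J h₁ h₂ := by
  have hl := DipolarIsing.lambdaMin_pos
  have hcm := DipolarIsing.cMin_pos
  obtain ⟨c, hc⟩ := DipolarIsing.exists_tendsto_stripeDipole
  -- Then `5 * η = λ_min / 6`, which is strictly less than `λ / 5` for every admissible `λ`.
  set η := DipolarIsing.lambdaMin / 30 with hη
  have hη0 : 0 < η := by positivity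
  have ev1 := hc.eventually (Icc_mem_nhds (by linarith : c - η < c) (by linarith : c < c + η))
  have ev2 : ∀ᶠ k : ℕ in Filter.atTop, 8 / (k : ℝ) + 2 * DipolarIsing.stripeDipole k ≤ η := by
    have := (tendsto_const_div_atTop_nhds_zero_nat (8 : ℝ)).add
      (DipolarIsing.tendsto_stripeDipole.const_mul 2)
    simp only [mul_zero, add_zero] at this
    exact this.eventually (Iic_mem_nhds hη0)
  have ev3 : ∀ᶠ k : ℕ in Filter.atTop, 4 / (k : ℝ) ≤ η :=
    (tendsto_const_div_atTop_nhds_zero_nat (4 : ℝ)).eventually (Iic_mem_nhds hη0)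
  obtain ⟨K, hK⟩ := Filter.eventually_atTop.1 (ev1.and (ev2.and ev3))
  -- Exponential growth is used twice: to make `2J / N ≤ η` (the extra `η` pays for `h < N + 1`),
  -- and to push `h` beyond the index `K` from which the asymptotics hold.
  obtain ⟨J₀, hJ₀⟩ := Filter.eventually_atTop.1
    ((DipolarIsing.eventually_two_mul_le (mul_pos hη0 hcm) hη0.le).and
      (DipolarIsing.eventually_two_mul_le hcm (b := K + 1) (by positivity)))
  refine ⟨max J₀ 2, lt_of_lt_of_le (by norm_num) (le_max_right _ _), ?_⟩
  intro J h lam h₁ h₂ hJ hmin _ hlam hlam2 e₁ e₂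
  obtain ⟨a1, a2⟩ := hJ₀ J ((le_max_left _ _).trans hJ.le)
  have hJ2 : 2 < J := (le_max_right _ _).trans_lt hJ
  have hhK : (K : ℝ) + 1 ≤ h := by linarith
  have hh : 0 < h := lt_of_lt_of_le (by positivity) hhK
  have hlam0 : 0 < lam := hl.trans_le hlam
  have hNh := Nat.floor_le hh.le
  have hhN := Nat.lt_floor_add_one h
  set N := ⌊h⌋₊
  have hKN : K + 1 ≤ N := Nat.le_floor (by exact_mod_cast hhK)
  have hN : 0 < N := by omega
  have hN' : (0 : ℝ) < N := by positivity
  have b₁ : h ≤ h₁ := by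
    rw [e₁, le_div_iff₀ hlam0]; nlinarith
  have b₂ : h ≤ h₂ := by
    rw [e₂, le_div_iff₀ (by linarith)]; nlinarith
  have k₁ : K ≤ h₁ := by
    have : (K : ℝ) ≤ h₁ := by linarith
    exact_mod_cast this
  have k₂ : K ≤ h₂ := by
    have : (K : ℝ) ≤ h₂ := by linarith
    exact_mod_cast this
  obtain ⟨⟨f1, -⟩, -, f3⟩ := hK N (by omega)
  obtain ⟨⟨-, g1⟩, -, -⟩ := hK h₁ k₁
  obtain ⟨⟨-, i1⟩, i2, -⟩ := hK h₂ k₂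
  refine DipolarIsing.stripeEnergy_lt_checkerboardEnergy (c := c) (η := η) (by linarith) hN hNh
    hhN.le hlam0 hlam2 e₁ e₂ (by linarith) ?_ f3 (by linarith) (by linarith) (by linarith) i2
  rw [div_le_iff₀ hN']
  have h1 : η * (DipolarIsing.cMin * Real.exp (J / 2)) ≤ η * (N + 1) := by
    gcongr; linarith
  linarith
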